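/- Let $d\ge 2$, $I=[0,1]$, and let $\mathcal D\subset\mathbb R^d$ be a smoothly embedded closed $d$-dimensional ball. Let $C\subset\mathcal D\times I$ be a covered region: writing $C_t=C\cap(\mathbb R^d\times\{t\})$, the set $C\subset\mathbb R^d\times I$ is a smoothly embedded compact $(d+1)$-dimensional manifold with corners which is a cobordism between the manifolds with boundary $C_0$ and $C_1$, that is, $\partial C=C_0\cup N\cup C_1$ where $N$ is an embedded $d$-dimensional manifold with boundary $\partial N=\partial C_0\sqcup\partial C_1$ and $N\cap C_i=\partial C_i$ for $i=0,1$; the set $\partial\mathcal D\times I$ is a connected component of $N$; and the critical points of the projection $N\to I$ are isolated and have distinct critical values, all lying in $(0,1)$. Let $B=N\setminus(\partial\mathcal D\times I)$ be the essential boundary, $X=((\mathcal D\times I)\setminus C)\cup B$ the uncovered region, and let $\mathcal E$ be the space of evasion paths, i.e. of continuous sections $I\to X$ of the projection $X\to I$, with the compact-open topology. Choose regular values $0=s_0<s_1<\dots<s_n=1$ of the projection $B\to I$ such that each $[s_i,s_{i+1}]$ contains at most one critical value of it (for example, values interleaving the critical values). Put $B_i=B\cap(\mathbb R^d\times\{s_i\})$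 and $B_i^{i+1}=B\cap(\mathbb R^d\times[s_i,s_{i+1}])$, and let $\widetilde{ZB}$ be the zigzag of inclusions $$B_0\hookrightarrow B_0^1\hookleftarrow B_1\hookrightarrow\cdots\hookrightarrow B_{n-1}^n\hookleftarrow B_n .$$ Let $k$ be a field, let $H^0(-;k)$ be degree-zero singular cohomology regarded as a $k$-algebra under the cup product, and let $\varprojlim \mathrm{Hom}_{k\text{-alg}}(H^0(\widetilde{ZB};k),k)$ be the inverse limit of the zigzag diagram of sets obtained by applying $\mathrm{Hom}_{k\text{-alg}}(H^0(-;k),k)$ to $\widetilde{ZB}$. Assume that $C_t$ is connected for every $t\in I$. Then there is a surjection $$\pi_0(\mathcal E)\longrightarrow\varprojlim \mathrm{Hom}_{k\text{-alg}}(H^0(\widetilde{ZB};k),k).$$ In particular, an evasion path exists (i.e. $\mathcal E\neq\emptyset$) if and only if this inverse limit is nonempty, and the cardinality of $\pi_0(\mathcal E)$ is at least the cardinality of the inverse limit. -/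

import Mathlib

open Set Topology
open scoped ContDiff

universe u

noncomputable section

namespace Evasion

/-! ### Singular cohomology in degree zero, with its cup product -/

/-- Singular `n`-simplices of a topological space. -/
abbrev SingularSimplex (n : ℕ) (A : Type*) [TopologicalSpace A] : Type _ :=
  C(stdSimplex ℝ (Fin (n + 1)), A)

/-- The `i`-th face of a singular simplex. -/
def SingularSimplex.face {n : ℕ} {A : Type*} [TopologicalSpace A]
    (σ : SingularSimplex (n + 1) A) (i : Fin (n + 2)) : SingularSimplex n A :=
  σ.comp ⟨stdSimplex.map i.succAbove, stdSimplex.continuous_map _⟩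

/-- Singular `n`-cochains with coefficients in `k`. -/
abbrev SingularCochain (n : ℕ) (k A : Type*) [TopologicalSpace A] : Type _ :=
  SingularSimplex n A → k

/-- The singular coboundary. -/
def coboundary {n : ℕ} {k A : Type*} [Ring k] [TopologicalSpace A]
    (φ : SingularCochain n k A) : SingularCochain (n + 1) k A :=
  fun σ => ∑ i : Fin (n + 2), (-1) ^ (i : ℕ) * φ (σ.face i)

theorem coboundary_zero_apply {k A : Type*} [Ring k] [TopologicalSpace A]
    (φ : SingularCochain 0 k A) (σ : SingularSimplex 1 A) :
    coboundary φ σ = φ (σ.face 0) - φ (σ.face 1) := by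
  simp [coboundary, Fin.sum_univ_two, sub_eq_add_neg]

/-- The `k`-algebra `H⁰(A; k)`: the `0`-cocycles of the singular cochain complex (there are no
nonzero `0`-coboundaries). The cup product of `0`-cochains is the pointwise product. -/
def H0 (k A : Type*) [Field k] [TopologicalSpace A] : Subalgebra k (SingularCochain 0 k A) where
  carrier := {φ | coboundary φ = 0}
  mul_mem' := by
    intro φ ψ hφ hψ
    funext σ
    have h1 := congrFun hφ σ
    have h2 := congrFun hψ σ
    rw [coboundary_zero_apply, Pi.zero_apply, sub_eq_zero] at h1 h2 ⊢
    simp [h1, h2]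
  add_mem' := by
    intro φ ψ hφ hψ
    funext σ
    have h1 := congrFun hφ σ
    have h2 := congrFun hψ σ
    rw [coboundary_zero_apply, Pi.zero_apply, sub_eq_zero] at h1 h2 ⊢
    simp [h1, h2]
  algebraMap_mem' := by
    intro c
    funext σ
    rw [coboundary_zero_apply]
    simp [Pi.algebraMap_apply]

/-- The algebra map `H⁰(A'; k) → H⁰(A; k)` induced by a continuous map `A → A'`. -/
def H0.map (k : Type*) [Field k] {A A' : Type*} [TopologicalSpace A] [TopologicalSpace A']
    (f : C(A, A')) : H0 k A' →ₐ[k] H0 k A where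
  toFun φ := ⟨fun σ => φ.1 (f.comp σ), by
    funext σ
    have h := congrFun φ.2 (f.comp σ)
    rw [coboundary_zero_apply] at h ⊢
    exact h⟩
  map_one' := rfl
  map_mul' _ _ := rfl
  map_zero' := rfl
  map_add' _ _ := rfl
  commutes' _ := rfl

/-- The set `Hom_{k-alg}(H⁰(A; k), k)`. -/
abbrev H0Dual (k A : Type*) [Field k] [TopologicalSpace A] : Type _ := H0 k A →ₐ[k] k

/-- The map `Hom_{k-alg}(H⁰(A; k), k) → Hom_{k-alg}(H⁰(A'; k), k)` induced by a continuous map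
`A → A'`. -/
def H0Dual.map {k : Type*} [Field k] {A A' : Type*} [TopologicalSpace A] [TopologicalSpace A']
    (f : C(A, A')) (χ : H0Dual k A) : H0Dual k A' :=
  χ.comp (H0.map k f)

/-! ### Embedded cobordisms of manifolds with boundary -/

/-- `ℝᵈ`. -/
abbrev Space (d : ℕ) : Type := EuclideanSpace ℝ (Fin d)

/-- `ℝᵈ × ℝ`, with time as second coordinate. -/
abbrev SpaceTime (d : ℕ) : Type := Space d × ℝ

/-- Smooth charts of `ℝᵈ × ℝ`: diffeomorphisms between open subsets of `ℝᵈ × ℝ` and `ℝᵈ⁺¹`. -/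
def IsSmoothChart {d : ℕ} (e : OpenPartialHomeomorph (SpaceTime d) (Space (d + 1))) : Prop :=
  ContDiffOn ℝ ∞ e e.source ∧ ContDiffOn ℝ ∞ e.symm e.target

/-- At `p`, the set `M` is a codimension-`0` submanifold with boundary, `p` lies on the boundary,
and `F` is the boundary of `M` near `p`. -/
def IsFacePoint {d : ℕ} (M F : Set (SpaceTime d)) (p : SpaceTime d) : Prop :=
  ∃ e : OpenPartialHomeomorph (SpaceTime d) (Space (d + 1)), IsSmoothChart e ∧
    p ∈ e.source ∧ e p 0 = 0 ∧
    e.source ∩ M = {q ∈ e.source | 0 ≤ e q 0} ∧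
    e.source ∩ F = {q ∈ e.source | e q 0 = 0}

/-- At `p`, the set `M` is a codimension-`0` submanifold with corners modelled on
`[0, ∞)² × ℝᵈ⁻¹`, `p` lies on the corner, and `F`, `G` are the two faces of `M` near `p`. -/
def IsCornerPoint {d : ℕ} (M F G : Set (SpaceTime d)) (p : SpaceTime d) : Prop :=
  ∃ e : OpenPartialHomeomorph (SpaceTime d) (Space (d + 1)), IsSmoothChart e ∧
    p ∈ e.source ∧ e p 0 = 0 ∧ e p 1 = 0 ∧
    e.source ∩ M = {q ∈ e.source | 0 ≤ e q 0 ∧ 0 ≤ e q 1} ∧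
    e.source ∩ F = {q ∈ e.source | e q 0 = 0 ∧ 0 ≤ e q 1} ∧
    e.source ∩ G = {q ∈ e.source | 0 ≤ e q 0 ∧ e q 1 = 0}

/-- `M ⊆ ℝᵈ × ℝ` is a smoothly embedded compact `(d+1)`-dimensional cobordism of manifolds with
boundary between `M₀` and `M₁`, with boundary `∂M = M₀ ∪ N ∪ M₁`. The pieces `M₀`, `N`, `M₁` are
embedded `d`-dimensional manifolds with boundary, `M₀ ∩ M₁ = ∅`, `∂M₀ = M₀ ∩ N`, `∂M₁ = M₁ ∩ N` and
`∂N = ∂M₀ ⊔ ∂M₁`; the corners of `M` are the points of `∂N`. All of this is expressed by charts of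
`M` adapted to the decomposition of its boundary. -/
structure IsCobordism {d : ℕ} (M M₀ N M₁ : Set (SpaceTime d)) : Prop where
  isCompact : IsCompact M
  boundary_eq : frontier M = M₀ ∪ N ∪ M₁
  disjoint : Disjoint M₀ M₁
  isClosed_left : IsClosed M₀
  isClosed_side : IsClosed N
  isClosed_right : IsClosed M₁
  face_left : ∀ p ∈ M₀ \ N, IsFacePoint M M₀ p
  face_side : ∀ p ∈ N \ (M₀ ∪ M₁), IsFacePoint M N p
  face_right : ∀ p ∈ M₁ \ N, IsFacePoint M M₁ p
  corner_left : ∀ p ∈ M₀ ∩ N, IsCornerPoint M M₀ N p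
  corner_right : ∀ p ∈ M₁ ∩ N, IsCornerPoint M M₁ N p

/-- Critical points of the projection `N → ℝ`, `(x, t) ↦ t`, of an embedded submanifold `N` of
`ℝᵈ × ℝ` (possibly with boundary): the projection vanishes on the tangent space of `N` at `p`. -/
def IsCriticalPoint {d : ℕ} (N : Set (SpaceTime d)) (p : SpaceTime d) : Prop :=
  p ∈ N ∧ ∀ v ∈ tangentConeAt ℝ N p, v.2 = 0

/-- Critical values of the projection `N → ℝ`. -/
def criticalValues {d : ℕ} (N : Set (SpaceTime d)) : Set ℝ :=
  Prod.snd '' {p | IsCriticalPoint N p}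

/-! ### The smoothed evasion path problem -/

/-- `D ⊆ ℝᵈ` is a smoothly embedded closed `d`-dimensional ball. -/
def IsSmoothBall {d : ℕ} (D : Set (Space d)) : Prop :=
  ∃ φ : Space d → Space d, ContDiff ℝ ∞ φ ∧ InjOn φ (Metric.closedBall 0 1) ∧
    (∀ x ∈ Metric.closedBall (0 : Space d) 1, Function.Injective (fderiv ℝ φ x)) ∧
    φ '' Metric.closedBall 0 1 = D

/-- The part of `M` at time `t`, as a subspace of `ℝᵈ × ℝ`. -/
def levelSet {d : ℕ} (M : Set (SpaceTime d)) (t : ℝ) : Set (SpaceTime d) :=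
  {p ∈ M | p.2 = t}

/-- The part of `M` over the time interval `[a, b]`. -/
def slab {d : ℕ} (M : Set (SpaceTime d)) (a b : ℝ) : Set (SpaceTime d) :=
  {p ∈ M | p.2 ∈ Icc a b}

theorem levelSet_subset_slab {d : ℕ} (M : Set (SpaceTime d)) {a b t : ℝ} (h : t ∈ Icc a b) :
    levelSet M t ⊆ slab M a b := by
  rintro p ⟨hp, rfl⟩
  exact ⟨hp, h⟩

/-- `C` is a covered region in `D × [0, 1]`, and `N` is the part of the boundary of `C` joining
`∂C₀` to `∂C₁`. -/
structure IsCoveredRegion {d : ℕ} (D : Set (Space d)) (C N : Set (SpaceTime d)) : Prop where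
  subset : C ⊆ D ×ˢ Icc 0 1
  isCobordism : IsCobordism C (levelSet C 0) N (levelSet C 1)
  wall_isComponent : ∃ p ∈ N, connectedComponentIn N p = frontier D ×ˢ Icc 0 1
  critical_isolated : ∀ p, IsCriticalPoint N p → ∀ᶠ q in 𝓝 p, IsCriticalPoint N q → q = p
  critical_injOn : InjOn Prod.snd {p | IsCriticalPoint N p}
  critical_mem : ∀ p, IsCriticalPoint N p → p.2 ∈ Ioo 0 1

/-- The essential boundary `B`. -/
def essentialBoundary {d : ℕ} (D : Set (Space d)) (N : Set (SpaceTime d)) : Set (SpaceTime d) :=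
  N \ (frontier D ×ˢ Icc 0 1)

/-- The uncovered region `X = ((D × [0, 1]) \ C) ∪ B`. -/
def uncoveredRegion {d : ℕ} (D : Set (Space d)) (C N : Set (SpaceTime d)) : Set (SpaceTime d) :=
  ((D ×ˢ Icc 0 1) \ C) ∪ essentialBoundary D N

/-- The space of evasion paths: continuous sections `[0, 1] → X` of the projection `X → [0, 1]`,
with the compact-open topology. -/
abbrev EvasionPath {d : ℕ} (D : Set (Space d)) (C N : Set (SpaceTime d)) : Type :=
  {δ : C(unitInterval, uncoveredRegion D C N) // ∀ t, (δ t : SpaceTime d).2 = t}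

/-- Regular values `0 = s₀ < s₁ < ⋯ < sₙ = 1` of the projection `B → [0, 1]` with at most one
critical value between consecutive ones. -/
structure Interleaving {d : ℕ} (B : Set (SpaceTime d)) (n : ℕ) where
  s : Fin (n + 1) → ℝ
  strictMono : StrictMono s
  zero : s 0 = 0
  last : s (Fin.last n) = 1
  regular : ∀ i, s i ∉ criticalValues B
  subsingleton : ∀ i : Fin n, (criticalValues B ∩ Icc (s i.castSucc) (s i.succ)).Subsingleton

/-- The inclusion of the level set at `sᵢ` into the slab over `[sᵢ, sᵢ₊₁]`. -/
def Interleaving.inclLeft {d n : ℕ} {B : Set (SpaceTime d)} (S : Interleaving B n)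
    (M : Set (SpaceTime d)) (i : Fin n) :
    C(levelSet M (S.s i.castSucc), slab M (S.s i.castSucc) (S.s i.succ)) :=
  ContinuousMap.inclusion
    (levelSet_subset_slab M (left_mem_Icc.2 (S.strictMono i.castSucc_lt_succ).le))

/-- The inclusion of the level set at `sᵢ₊₁` into the slab over `[sᵢ, sᵢ₊₁]`. -/
def Interleaving.inclRight {d n : ℕ} {B : Set (SpaceTime d)} (S : Interleaving B n)
    (M : Set (SpaceTime d)) (i : Fin n) :
    C(levelSet M (S.s i.succ), slab M (S.s i.castSucc) (S.s i.succ)) :=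
  ContinuousMap.inclusion
    (levelSet_subset_slab M (right_mem_Icc.2 (S.strictMono i.castSucc_lt_succ).le))

/-- The inverse limit of the zigzag of sets
`Hom(H⁰(M₀), k) → Hom(H⁰(M₀¹), k) ← Hom(H⁰(M₁), k) → ⋯ ← Hom(H⁰(Mₙ), k)`: compatible families. -/
def ZigzagLimit (k : Type*) [Field k] {d n : ℕ} {B : Set (SpaceTime d)} (S : Interleaving B n)
    (M : Set (SpaceTime d)) : Type _ :=
  {χ : (∀ i : Fin (n + 1), H0Dual k (levelSet M (S.s i))) ×
      (∀ i : Fin n, H0Dual k (slab M (S.s i.castSucc) (S.s i.succ))) //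
    ∀ i : Fin n, H0Dual.map (S.inclLeft M i) (χ.1 i.castSucc) = χ.2 i ∧
      H0Dual.map (S.inclRight M i) (χ.1 i.succ) = χ.2 i}

end Evasion

end

namespace Evasion

/-! ### Unicoherence of convex sets -/

/-! Two facts reduce the problem to path components of the essential boundary `B`.

Connectivity. Let `Y` be the union of `C` with the exterior of `D` over `[0, 1]`. The uncovered
region `X` and `Y` are closed, they cover `ℝᵈ × [0, 1]`, and they meet exactly in `B`. Since every
`C_t` is connected, `Y` is connected over each time interval. A convex set is unicoherent
(`mem_connectedComponentIn_inter_of_convex`), so two points of `B` that lie in one component of `X`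
over `[a, b]` already lie in one component of `B` over `[a, b]` (`connIn_slab_essentialBoundary`).
Moreover every point of `X` at time `t` is joined to `B` inside its time slice, because a segment
towards `C_t` has to cross `B` (`exists_connIn_levelSet`).

Characters. The level sets and slabs of `B` at regular times are compact and locally path-connected,
so the characters of their `H⁰` are evaluations at points, and two evaluations agree exactly when
the points are joined by a path. The inverse limit therefore consists of compatible families of path
components. An evasion path selects at each `sᵢ` the component of `B` lying in its component of the
slice of `X`. Connectivity makes this choice compatible and unchanged along paths of evasion paths.

Surjectivity. A compatible family gives points `xᵢ` of `B` at time `sᵢ` such that consecutive ones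
lie in one component of `X` over `[sᵢ, sᵢ₊₁]`. They must be joined by a section (`reach_of_connIn`).
Away from critical points, the set reachable from `xᵢ` is open and closed, so an obstruction can
only sit at the one critical point `p` of the slab. If `xᵢ₊₁` were not reached, both the points
reachable from `xᵢ` and the points from which `xᵢ₊₁` is reachable would accumulate at `p`. No Morse
nondegeneracy is needed at `p`: a defining function of `X` has purely vertical derivative there, so
the slices of `X` near `p` grow or shrink monotonically. Hence the vertical line through `p` enters
the interior of `X` just after or just before `p`, and forward and backward sections can be made to
meet on that line. -/

theorem exists_real_lift_of_contractible {A : Type*} [TopologicalSpace A] [ContractibleSpace A]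
    (θ : C(A, AddCircle (1 : ℝ))) : ∃ g : C(A, ℝ), ∀ a, (g a : AddCircle (1 : ℝ)) = θ a := by
  obtain ⟨a₀, ⟨H⟩⟩ := (contractible_iff_id_nullhomotopic A).1 ‹_›
  obtain ⟨r, hr⟩ := QuotientAddGroup.mk_surjective (θ a₀)
  have cov := AddCircle.isCoveringMap_coe (1 : ℝ)
  -- The reversed contraction starts at a constant map, which has a constant lift, and ends at `θ`;
  -- homotopy lifting carries the lift along.
  let H' : C(unitInterval × A, AddCircle (1 : ℝ)) := θ.comp H.symm.toContinuousMap
  have h0 : ∀ a, H' (0, a) = (((ContinuousMap.const A r) a : ℝ) : AddCircle (1 : ℝ)) := by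
    intro a
    have : H.symm (0, a) = a₀ := by simp
    change θ (H.symm (0, a)) = _
    rw [this]
    exact hr.symm
  refine ⟨(cov.liftHomotopy H' (ContinuousMap.const A r) h0).comp
    ((ContinuousMap.const A 1).prodMk (ContinuousMap.id A)), fun a => ?_⟩
  have h1 := congrFun (cov.liftHomotopy_lifts H' (ContinuousMap.const A r) h0) (1, a)
  have : H.symm (1, a) = a := by simp
  have h2 : H' (1, a) = θ a := congrArg θ this
  rw [← h2]
  exact h1

theorem exists_real_lift_of_convex {T : Type*} [NormedAddCommGroup T] [NormedSpace ℝ T]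
    {A : Set T} (hA : Convex ℝ A) {θ : T → AddCircle (1 : ℝ)} (hθ : ContinuousOn θ A) :
    ∃ g : T → ℝ, ContinuousOn g A ∧ ∀ a ∈ A, (g a : AddCircle (1 : ℝ)) = θ a := by
  classical
  rcases A.eq_empty_or_nonempty with rfl | hne
  · exact ⟨0, continuousOn_empty _, by simp⟩
  have := hA.contractibleSpace hne
  obtain ⟨g, hg⟩ := exists_real_lift_of_contractible
    (⟨A.domRestrict θ, continuousOn_iff_continuous_domRestrict.1 hθ⟩ : C(A, AddCircle (1 : ℝ)))
  refine ⟨fun x => if h : x ∈ A then g ⟨x, h⟩ else 0, ?_, fun a ha => ?_⟩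
  · rw [continuousOn_iff_continuous_domRestrict]
    convert g.continuous with x
    simp
  · simp only [ha, dite_true]
    exact hg ⟨a, ha⟩

/-- The difference of two lifts is continuous with values in the discrete group of integers, hence
constant on a connected set. -/
theorem sub_eq_sub_of_coe_eq {T : Type*} [TopologicalSpace T] {K : Set T}
    (hK : IsPreconnected K) {f g : T → ℝ} (hf : ContinuousOn f K) (hg : ContinuousOn g K)
    (h : ∀ x ∈ K, (f x : AddCircle (1 : ℝ)) = g x) {x y : T} (hx : x ∈ K) (hy : y ∈ K) :
    f x - g x = f y - g y := by
  have hd : DiscreteTopology ((AddSubgroup.zmultiples (1 : ℝ) : AddSubgroup ℝ) : Set ℝ) :=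
    inferInstanceAs (DiscreteTopology (AddSubgroup.zmultiples (1 : ℝ)))
  refine hK.constant_of_mapsTo (T := (AddSubgroup.zmultiples (1 : ℝ) : Set ℝ))
    ⟨hd⟩ (hf.sub hg) (fun z hz => ?_) hx hy
  have := QuotientAddGroup.eq.1 (h z hz).symm
  simpa [sub_eq_neg_add] using this

/-- In a compact Hausdorff space a component is the intersection of the clopen sets containing it,
so some clopen set separates the two points. -/
theorem exists_closed_partition {T : Type*} [TopologicalSpace T] [T2Space T] {B : Set T}
    (hB : IsCompact B) {b b' : T} (hb : b ∈ B) (hb' : b' ∈ B)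
    (h : b' ∉ connectedComponentIn B b) :
    ∃ P Q : Set T, IsClosed P ∧ IsClosed Q ∧ Disjoint P Q ∧ P ∪ Q = B ∧ b ∈ P ∧ b' ∈ Q := by
  have := isCompact_iff_compactSpace.1 hB
  have h1 : (⟨b', hb'⟩ : B) ∉ connectedComponent (⟨b, hb⟩ : B) := by
    intro h2
    apply h
    rw [connectedComponentIn_eq_image hb]
    exact ⟨_, h2, rfl⟩
  rw [connectedComponent_eq_iInter_isClopen] at h1
  simp only [mem_iInter, not_forall] at h1
  obtain ⟨⟨Z, hZ, hbZ⟩, hb'Z⟩ := h1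
  refine ⟨Subtype.val '' Z, Subtype.val '' Zᶜ, ?_, ?_, ?_, ?_, ⟨_, hbZ, rfl⟩, ⟨_, hb'Z, rfl⟩⟩
  · exact (hZ.1.isCompact.image continuous_subtype_val).isClosed
  · exact (hZ.compl.1.isCompact.image continuous_subtype_val).isClosed
  · exact (disjoint_image_iff Subtype.val_injective).2 disjoint_compl_right
  · rw [← image_union, union_compl_self, image_univ, Subtype.range_coe]

/-- A convex set is unicoherent: if it is the union of closed sets `X` and `Y` with `Y` connected,
then points of `X ∩ Y` in the same component of `X` lie in the same component of `X ∩ Y`. -/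
theorem mem_connectedComponentIn_inter_of_convex {T : Type*} [NormedAddCommGroup T]
    [NormedSpace ℝ T] {X Y K : Set T} (hX : IsClosed X) (hY : IsClosed Y)
    (hXY : Convex ℝ (X ∪ Y)) (hYc : IsPreconnected Y) (hB : IsCompact (X ∩ Y))
    (hK : IsPreconnected K) (hKX : K ⊆ X) {b b' : T} (hb : b ∈ K) (hbY : b ∈ Y)
    (hb' : b' ∈ K) (hb'Y : b' ∈ Y) : b' ∈ connectedComponentIn (X ∩ Y) b := by
  classical
  by_contra h
  obtain ⟨P, Q, hP, hQ, hPQ, hPQB, hbP, hbQ⟩ :=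
    exists_closed_partition hB ⟨hKX hb, hbY⟩ ⟨hKX hb', hb'Y⟩ h
  obtain ⟨u, hu0, hu1, -⟩ := exists_continuous_zero_one_of_isClosed hP hQ hPQ
  -- Modulo `1` these agree on `P` (values `0` and `1`) and on `Q` (both `1 / 2`). They glue to a
  -- circle-valued map that runs half a turn in each direction from `P` to `Q`.
  let f₁ : T → ℝ := fun x => u x / 2
  let f₂ : T → ℝ := fun x => 1 - u x / 2
  have hf₁ : Continuous f₁ := by fun_prop
  have hf₂ : Continuous f₂ := by fun_prop
  have hagree : ∀ x ∈ X ∩ Y, (f₁ x : AddCircle (1 : ℝ)) = f₂ x := by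
    intro x hx
    rw [← hPQB] at hx
    rcases hx with hx | hx
    · have : u x = 0 := hu0 hx
      simpa [f₁, f₂, this] using (AddCircle.coe_period (1 : ℝ)).symm
    · have : u x = 1 := hu1 hx
      simp only [f₁, f₂, this]
      norm_num
  let θ : T → AddCircle (1 : ℝ) := fun x => if x ∈ X then (f₁ x : AddCircle (1 : ℝ)) else f₂ x
  have hθX : ∀ x ∈ X, θ x = f₁ x := fun x hx => by simp [θ, hx]
  have hθY : ∀ x ∈ Y, θ x = f₂ x := fun x hx => by
    by_cases hxX : x ∈ X
    · rw [hθX x hxX, hagree x ⟨hxX, hx⟩]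
    · simp [θ, hxX]
  have hθ : ContinuousOn θ (X ∪ Y) := by
    refine ContinuousOn.union_of_isClosed ?_ ?_ hX hY
    · exact ((AddCircle.continuous_mk' 1).comp hf₁).continuousOn.congr hθX
    · exact ((AddCircle.continuous_mk' 1).comp hf₂).continuousOn.congr hθY
  obtain ⟨g, hg, hgθ⟩ := exists_real_lift_of_convex hXY hθ
  -- Along `K` the lift gains `1 / 2` from `b` to `b'`, whereas along `Y` it loses `1 / 2`.
  have e₁ := sub_eq_sub_of_coe_eq hK
    (hg.mono (hKX.trans subset_union_left)) hf₁.continuousOn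
    (fun x hx => by rw [hgθ x (.inl (hKX hx)), hθX x (hKX hx)]) hb hb'
  have e₂ := sub_eq_sub_of_coe_eq hYc
    (hg.mono subset_union_right) hf₂.continuousOn
    (fun x hx => by rw [hgθ x (.inr hx), hθY x hx]) hbY hb'Y
  have h0 : u b = 0 := hu0 hbP
  have h1 : u b' = 1 := hu1 hbQ
  simp only [f₁, f₂, h0, h1] at e₁ e₂
  linarith

/-! ### Reachability along sections -/

section Reach

variable {E : Type*} [NormedAddCommGroup E] {Z Z' : Set (E × ℝ)}
  {p q r x y m : E × ℝ}

/-- `r` can be reached from `q` along a continuous section of the projection `Z → ℝ`. -/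
def Reach (Z : Set (E × ℝ)) (q r : E × ℝ) : Prop :=
  q.2 ≤ r.2 ∧ ∃ σ : ℝ → E, ContinuousOn σ (Icc q.2 r.2) ∧ (∀ t ∈ Icc q.2 r.2, (σ t, t) ∈ Z) ∧
    σ q.2 = q.1 ∧ σ r.2 = r.1

theorem Reach.refl (h : q ∈ Z) : Reach Z q q :=
  ⟨le_rfl, fun _ => q.1, continuousOn_const, fun t ht => by
    rw [Icc_self, mem_singleton_iff] at ht
    subst ht
    exact h, rfl, rfl⟩

theorem Reach.left_mem (h : Reach Z q r) : q ∈ Z := by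
  obtain ⟨hle, σ, -, hσ, h0, -⟩ := h
  have := hσ q.2 (left_mem_Icc.2 hle)
  rwa [h0] at this

theorem Reach.right_mem (h : Reach Z q r) : r ∈ Z := by
  obtain ⟨hle, σ, -, hσ, -, h1⟩ := h
  have := hσ r.2 (right_mem_Icc.2 hle)
  rwa [h1] at this

theorem Reach.eq_of_snd_eq (h : Reach Z q r) (hqr : q.2 = r.2) : q = r := by
  obtain ⟨-, σ, -, -, h0, h1⟩ := h
  exact Prod.ext (by rw [← h0, ← h1, hqr]) hqr

theorem Reach.mono (h : Reach Z q r) (hZ : ∀ z ∈ Z, z.2 ∈ Icc q.2 r.2 → z ∈ Z') :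
    Reach Z' q r := by
  obtain ⟨hle, σ, hc, hσ, h0, h1⟩ := h
  exact ⟨hle, σ, hc, fun t ht => hZ _ (hσ t ht) ht, h0, h1⟩

theorem Reach.trans (h : Reach Z q r) (h' : Reach Z r m) : Reach Z q m := by
  obtain ⟨hle, σ, hc, hσ, h0, h1⟩ := h
  obtain ⟨hle', σ', hc', hσ', h0', h1'⟩ := h'
  let τ : ℝ → E := fun t => if t ≤ r.2 then σ t else σ' t
  have e1 : ∀ t ∈ Icc q.2 r.2, τ t = σ t := fun t ht => by simp [τ, ht.2]
  have e2 : ∀ t ∈ Icc r.2 m.2, τ t = σ' t := fun t ht => by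
    rcases ht.1.eq_or_lt with h | h
    · subst h; simp [τ, h1, h0']
    · simp [τ, h.not_ge]
  refine ⟨hle.trans hle', τ, ?_, ?_, ?_, ?_⟩
  · rw [← Icc_union_Icc_eq_Icc hle hle']
    exact (hc.congr e1).union_of_isClosed (hc'.congr e2) isClosed_Icc isClosed_Icc
  · intro t ht
    rw [← Icc_union_Icc_eq_Icc hle hle'] at ht
    rcases ht with ht | ht
    · rw [e1 t ht]; exact hσ t ht
    · rw [e2 t ht]; exact hσ' t ht
  · rw [e1 _ (left_mem_Icc.2 hle), h0]
  · rw [e2 _ (right_mem_Icc.2 hle'), h1']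

theorem Reach.exists_mid (h : Reach Z q r) {t : ℝ} (ht : t ∈ Icc q.2 r.2) :
    ∃ m ∈ Z, m.2 = t ∧ Reach Z q m ∧ Reach Z m r := by
  obtain ⟨hle, σ, hc, hσ, h0, h1⟩ := h
  exact ⟨(σ t, t), hσ t ht, rfl,
    ⟨ht.1, σ, hc.mono (Icc_subset_Icc_right ht.2), fun s hs => hσ s (Icc_subset_Icc_right ht.2 hs),
      h0, rfl⟩,
    ⟨ht.2, σ, hc.mono (Icc_subset_Icc_left ht.1), fun s hs => hσ s (Icc_subset_Icc_left ht.1 hs),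
      rfl, h1⟩⟩

theorem Reach.exists_isPreconnected (h : Reach Z q r) :
    ∃ K ⊆ Z, IsPreconnected K ∧ q ∈ K ∧ r ∈ K ∧ ∀ k ∈ K, k.2 ∈ Icc q.2 r.2 := by
  obtain ⟨hle, σ, hc, hσ, h0, h1⟩ := h
  refine ⟨(fun t => (σ t, t)) '' Icc q.2 r.2, ?_, ?_, ?_, ?_, ?_⟩
  · rintro _ ⟨t, ht, rfl⟩
    exact hσ t ht
  · exact isPreconnected_Icc.image _ (hc.prodMk continuousOn_id)
  · exact ⟨q.2, left_mem_Icc.2 hle, Prod.ext h0 rfl⟩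
  · exact ⟨r.2, right_mem_Icc.2 hle, Prod.ext h1 rfl⟩
  · rintro _ ⟨t, ht, rfl⟩
    exact ht

/-- The reflection of time. -/
def flipTime {E : Type*} (q : E × ℝ) : E × ℝ := (q.1, -q.2)

@[simp] theorem flipTime_fst {E : Type*} (q : E × ℝ) : (flipTime q).1 = q.1 := rfl

@[simp] theorem flipTime_snd {E : Type*} (q : E × ℝ) : (flipTime q).2 = -q.2 := rfl

@[simp] theorem flipTime_flipTime {E : Type*} (q : E × ℝ) : flipTime (flipTime q) = q := by
  simp [flipTime]

theorem continuous_flipTime : Continuous (flipTime : E × ℝ → E × ℝ) := by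
  unfold flipTime
  fun_prop

theorem Reach.flip (h : Reach Z q r) : Reach (flipTime ⁻¹' Z) (flipTime r) (flipTime q) := by
  obtain ⟨hle, σ, hc, hσ, h0, h1⟩ := h
  refine ⟨by simpa using hle, fun t => σ (-t), ?_, ?_, by simpa using h1, by simpa using h0⟩
  · refine hc.comp continuous_neg.continuousOn fun t ht => ?_
    simp only [flipTime_snd, mem_Icc] at ht ⊢
    constructor <;> linarith [ht.1, ht.2]
  · intro t ht
    simp only [flipTime_snd, mem_Icc] at ht
    exact hσ (-t) ⟨by linarith [ht.2], by linarith [ht.1]⟩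

theorem preimage_flipTime_preimage_flipTime {E : Type*} (Z : Set (E × ℝ)) :
    flipTime ⁻¹' (flipTime ⁻¹' Z) = Z := by
  ext q
  simp

theorem reach_flipTime_iff :
    Reach (flipTime ⁻¹' Z) (flipTime r) (flipTime q) ↔ Reach Z q r :=
  ⟨fun h => by simpa [preimage_flipTime_preimage_flipTime] using h.flip, Reach.flip⟩

theorem Reach.exists_lt_mem (h : Reach Z q r) (hlt : q.2 < r.2) {U : Set (E × ℝ)} (hU : IsOpen U)
    (hr : r ∈ U) : ∃ m ∈ U ∩ Z, q.2 < m.2 ∧ m.2 < r.2 ∧ Reach Z q m ∧ Reach Z m r := by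
  obtain ⟨hle, σ, hc, hσ, h0, h1⟩ := h
  have hτ : ContinuousWithinAt (fun t => (σ t, t)) (Icc q.2 r.2) r.2 :=
    (hc.prodMk continuousOn_id) _ (right_mem_Icc.2 hle)
  have hev : ∀ᶠ t in 𝓝[Icc q.2 r.2] r.2, (σ t, t) ∈ U :=
    hτ.eventually (hU.mem_nhds (by simpa only [h1] using hr))
  have hev' : ∀ᶠ t in 𝓝[Ioo q.2 r.2] r.2, (σ t, t) ∈ U :=
    hev.filter_mono (nhdsWithin_mono _ Ioo_subset_Icc_self)
  have : (𝓝[Ioo q.2 r.2] r.2).NeBot := right_nhdsWithin_Ioo_neBot hlt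
  obtain ⟨t, htU, ht⟩ := (hev'.and self_mem_nhdsWithin).exists
  have ht' := Ioo_subset_Icc_self ht
  refine ⟨(σ t, t), ⟨htU, hσ t ht'⟩, ht.1, ht.2,
    ⟨ht'.1, σ, hc.mono (Icc_subset_Icc_right ht'.2),
      fun s hs => hσ s (Icc_subset_Icc_right ht'.2 hs), h0, rfl⟩,
    ⟨ht'.2, σ, hc.mono (Icc_subset_Icc_left ht'.1),
      fun s hs => hσ s (Icc_subset_Icc_left ht'.1 hs), rfl, h1⟩⟩

theorem Reach.exists_gt_mem (h : Reach Z q r) (hlt : q.2 < r.2) {U : Set (E × ℝ)} (hU : IsOpen U)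
    (hq : q ∈ U) : ∃ m ∈ U ∩ Z, q.2 < m.2 ∧ m.2 < r.2 ∧ Reach Z q m ∧ Reach Z m r := by
  obtain ⟨m, ⟨hmU, hmZ⟩, h1, h2, h3, h4⟩ := h.flip.exists_lt_mem (by simpa using hlt)
    (hU.preimage continuous_flipTime) (by simpa using hq)
  refine ⟨flipTime m, ⟨hmU, hmZ⟩, ?_, ?_, ?_, ?_⟩
  · simp at h2 ⊢; linarith
  · simp at h1 ⊢; linarith
  · rw [← reach_flipTime_iff]; simpa using h4
  · rw [← reach_flipTime_iff]; simpa using h3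

/-- Near `q`, any two points of `Z` at distinct times are joined by a section. -/
def RegularAt (Z : Set (E × ℝ)) (q : E × ℝ) : Prop :=
  ∃ U, IsOpen U ∧ q ∈ U ∧ ∀ r ∈ U ∩ Z, ∀ r' ∈ U ∩ Z, r.2 < r'.2 → Reach Z r r'

theorem RegularAt.inter_of_ordConnected (h : RegularAt Z q) {J : Set ℝ} (hJ : J.OrdConnected) :
    RegularAt (Z ∩ Prod.snd ⁻¹' J) q := by
  obtain ⟨U, hU, hq, h⟩ := h
  refine ⟨U, hU, hq, fun r hr r' hr' hlt => ?_⟩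
  exact (h r ⟨hr.1, hr.2.1⟩ r' ⟨hr'.1, hr'.2.1⟩ hlt).mono
    fun z hz hzt => ⟨hz, hJ.out hr.2.2 hr'.2.2 hzt⟩

theorem RegularAt.flip (h : RegularAt Z q) : RegularAt (flipTime ⁻¹' Z) (flipTime q) := by
  obtain ⟨U, hU, hq, h⟩ := h
  refine ⟨flipTime ⁻¹' U, hU.preimage continuous_flipTime, by simpa using hq, ?_⟩
  intro r hr r' hr' hlt
  rw [← flipTime_flipTime r, ← flipTime_flipTime r', reach_flipTime_iff]
  exact h _ hr' _ hr (by simpa using hlt)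

/-- Distinct points of one time slice never reach each other, but nearby ones have the same future:
a section leaving `r` passes a slightly later point near `q`, which `r'` reaches as well. -/
theorem RegularAt.reach_congr (hZ : RegularAt Z q) :
    ∃ U, IsOpen U ∧ q ∈ U ∧ ∀ r ∈ U ∩ Z, ∀ r' ∈ U ∩ Z, r.2 = r'.2 → ∀ y, r.2 < y.2 →
      (Reach Z r y ↔ Reach Z r' y) := by
  obtain ⟨U, hU, hq, h⟩ := hZ
  have key : ∀ r ∈ U ∩ Z, ∀ r' ∈ U ∩ Z, r.2 = r'.2 → ∀ y, r.2 < y.2 →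
      Reach Z r y → Reach Z r' y := by
    intro r hr r' hr' hrr' y hy hry
    obtain ⟨m, hm, h1, -, -, h4⟩ := hry.exists_gt_mem hy hU hr.1
    exact (h r' hr' m hm (hrr' ▸ h1)).trans h4
  exact ⟨U, hU, hq, fun r hr r' hr' e y hy =>
    ⟨key r hr r' hr' e y hy, key r' hr' r hr e.symm y (e ▸ hy)⟩⟩

/-- A clopen part of a time slice is separated from the rest of the slice by nearby times. -/
theorem eventually_not_joined_of_slice_partition (hZ : IsCompact Z) {t₀ : ℝ} {T : Set (E × ℝ)}
    (hT : IsClosed T) (hT' : IsClosed ((Z ∩ Prod.snd ⁻¹' {t₀}) \ T))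
    (hTZ : T ⊆ Z) (hr : r ∈ (Z ∩ Prod.snd ⁻¹' {t₀}) \ T) :
    ∀ᶠ q in 𝓝 r, ∀ m ∈ T, ∀ K ⊆ Z, IsPreconnected K → m ∈ K → q ∈ K →
      ¬ ∀ k ∈ K, k.2 ∈ uIcc t₀ q.2 := by
  have hTc : IsCompact T := hZ.of_isClosed_subset hT hTZ
  have hTc' : IsCompact ((Z ∩ Prod.snd ⁻¹' {t₀}) \ T) :=
    hZ.of_isClosed_subset hT' (sdiff_subset.trans inter_subset_left)
  obtain ⟨U₁, U₂, hU₁, hU₂, h₁, h₂, hd⟩ := SeparatedNhds.of_isCompact_isCompact hTc hTc'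
    disjoint_sdiff_right
  -- By compactness, `Z` at times close to `t₀` stays inside the disjoint union of `U₁` and `U₂`, so
  -- a connected set over such times lies in one of them.
  have hW : IsCompact (Prod.snd '' (Z \ (U₁ ∪ U₂))) :=
    (hZ.diff (hU₁.union hU₂)).image continuous_snd
  have ht₀ : t₀ ∉ Prod.snd '' (Z \ (U₁ ∪ U₂)) := by
    rintro ⟨z, ⟨hz, hzU⟩, rfl⟩
    apply hzU
    by_cases hzT : z ∈ T
    · exact .inl (h₁ hzT)
    · exact .inr (h₂ ⟨⟨hz, rfl⟩, hzT⟩)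
  obtain ⟨ε, hε, hball⟩ := Metric.isOpen_iff.1 hW.isClosed.isOpen_compl t₀ ht₀
  have hrt : r.2 = t₀ := hr.1.2
  have e1 : ∀ᶠ q in 𝓝 r, q ∈ U₂ := hU₂.mem_nhds (h₂ hr)
  have e2 : ∀ᶠ q : E × ℝ in 𝓝 r, q.2 ∈ Metric.ball t₀ ε :=
    continuous_snd.continuousAt.eventually
      (Metric.isOpen_ball.mem_nhds (by rw [hrt]; exact Metric.mem_ball_self hε))
  filter_upwards [e1, e2] with q hq2 hqt m hm K hKZ hK hmK hqK hlev
  have hKU : K ⊆ U₁ ∪ U₂ := by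
    intro k hk
    by_contra hkU
    have hk2 : k.2 ∈ Metric.ball t₀ ε := by
      rw [Real.ball_eq_Ioo] at hqt ⊢
      exact ordConnected_Ioo.uIcc_subset (by constructor <;> linarith) hqt (hlev k hk)
    exact hball hk2 ⟨k, ⟨hKZ hk, hkU⟩, rfl⟩
  rcases hK.subset_or_subset hU₁ hU₂ hd hKU with h | h
  · exact hd.le_bot ⟨h hqK, hq2⟩
  · exact hd.le_bot ⟨h₁ hm, h hmK⟩

/-- The points reachable from `x`, including those points of the initial time slice that reach the
same later points as `x`. -/
def reachSet (Z : Set (E × ℝ)) (x : E × ℝ) : Set (E × ℝ) :=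
  {z ∈ Z | z.2 = x.2 ∧ ∀ y, x.2 < y.2 → (Reach Z x y ↔ Reach Z z y)} ∪
    {r | x.2 < r.2 ∧ Reach Z x r}

theorem mem_reachSet_iff_of_lt (h : x.2 < r.2) : r ∈ reachSet Z x ↔ Reach Z x r := by
  constructor
  · rintro (⟨-, h', -⟩ | h')
    · exact absurd h' h.ne'
    · exact h'.2
  · exact fun h' => .inr ⟨h, h'⟩

theorem Reach.mem_reachSet (h : Reach Z x r) : r ∈ reachSet Z x := by
  rcases h.1.eq_or_lt with he | hlt
  · have := h.eq_of_snd_eq he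
    subst this
    exact .inl ⟨h.left_mem, rfl, fun _ _ => Iff.rfl⟩
  · exact .inr ⟨hlt, h⟩

theorem reachSet_subset : reachSet Z x ⊆ Z := by
  rintro r (h | h)
  · exact h.1
  · exact h.2.right_mem

theorem Reach.trans_mem_reachSet (hq : q ∈ reachSet Z x) (h : Reach Z q r) :
    r ∈ reachSet Z x := by
  rcases hq with hq | hq
  · rcases h.1.eq_or_lt with he | hlt
    · rw [← h.eq_of_snd_eq he]
      exact .inl hq
    · have hlt' : x.2 < r.2 := hq.2.1 ▸ hlt
      exact .inr ⟨hlt', (hq.2.2 r hlt').2 h⟩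
  · exact .inr ⟨hq.1.trans_le h.1, hq.2.trans h⟩

/-- Regularity propagates reachability to later nearby points at once. Limits from later times are
the delicate case; they are traced back to the slice of the limit point, and compactness of `Z` is
used there. -/
theorem isClosed_reachSet (hZ : IsCompact Z) (hZx : ∀ z ∈ Z, x.2 ≤ z.2)
    (hreg₀ : ∀ z ∈ Z, z.2 = x.2 → RegularAt Z z)
    (hreg : ∀ r ∈ closure {r | x.2 < r.2 ∧ Reach Z x r}, RegularAt Z r) :
    IsClosed (reachSet Z x) ∧ IsClosed (Z \ reachSet Z x) := by
  have hZc : IsClosed Z := hZ.isClosed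
  set S : Set (E × ℝ) := {z ∈ Z | z.2 = x.2 ∧ ∀ y, x.2 < y.2 → (Reach Z x y ↔ Reach Z z y)} with hS
  have hSsub : S ⊆ reachSet Z x := subset_union_left
  have hslice : IsClosed (Z ∩ Prod.snd ⁻¹' {x.2}) :=
    hZc.inter (isClosed_singleton.preimage continuous_snd)
  have hSc : IsClosed S := by
    refine isClosed_of_closure_subset fun z hz => ?_
    have hSZ : S ⊆ Z ∩ Prod.snd ⁻¹' {x.2} := fun w hw => ⟨hw.1, hw.2.1⟩
    have hz' := closure_minimal hSZ hslice hz
    obtain ⟨U, hU, hzU, h⟩ := (hreg₀ z hz'.1 hz'.2).reach_congr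
    obtain ⟨w, hwU, hw⟩ := mem_closure_iff.1 hz U hU hzU
    have hzx : z.2 = x.2 := hz'.2
    refine ⟨hz'.1, hzx, fun y hy => (hw.2.2 y hy).trans ?_⟩
    exact h w ⟨hwU, hw.1⟩ z ⟨hzU, hz'.1⟩ (by rw [hw.2.1, hzx]) y (by rw [hw.2.1]; exact hy)
  have hSc' : IsClosed ((Z ∩ Prod.snd ⁻¹' {x.2}) \ S) := by
    refine isClosed_of_closure_subset fun z hz => ?_
    have hz' : z ∈ Z ∩ Prod.snd ⁻¹' {x.2} := closure_minimal sdiff_subset hslice hz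
    obtain ⟨U, hU, hzU, h⟩ := (hreg₀ z hz'.1 hz'.2).reach_congr
    obtain ⟨w, hwU, hw⟩ := mem_closure_iff.1 hz U hU hzU
    have hzx : z.2 = x.2 := hz'.2
    have hwx : w.2 = x.2 := hw.1.2
    refine ⟨hz', fun hzS => hw.2 ⟨hw.1.1, hwx, fun y hy => (hzS.2.2 y hy).trans ?_⟩⟩
    exact h z ⟨hzU, hz'.1⟩ w ⟨hwU, hw.1.1⟩ (by rw [hwx, hzx]) y (by rw [hzx]; exact hy)
  have hreg' : ∀ r ∈ closure (reachSet Z x), RegularAt Z r := by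
    intro r hr
    rw [reachSet, closure_union] at hr
    rcases hr with hr | hr
    · rw [← hS, hSc.closure_eq] at hr
      exact hreg₀ r hr.1 hr.2.1
    · exact hreg r hr
  -- The reachable set is open in `Z`: starting from `r` itself in the initial slice, or from a
  -- slightly earlier point of a section ending at `r`, regularity reaches all neighbours.
  have hopen : IsClosed (Z \ reachSet Z x) := by
    refine isClosed_of_closure_subset fun r hr => ?_
    have hrZ : r ∈ Z := closure_minimal sdiff_subset hZc hr
    refine ⟨hrZ, fun hrR => ?_⟩
    obtain ⟨U, hU, hrU, h⟩ := hreg' r (subset_closure hrR)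
    rcases hrR with hrS | ⟨hlt, hxr⟩
    · obtain ⟨w, ⟨hwU, hw⟩, hwR⟩ := mem_closure_iff.1 hr _ (hU.inter hSc'.isOpen_compl)
        ⟨hrU, fun h => h.2 hrS⟩
      rcases (hZx w hwR.1).eq_or_lt with he | hlt
      · apply hw
        exact ⟨⟨hwR.1, he.symm⟩, fun h => hwR.2 (hSsub h)⟩
      · exact hwR.2 (Reach.trans_mem_reachSet (hSsub hrS)
          (h r ⟨hrU, hrZ⟩ w ⟨hwU, hwR.1⟩ (by rw [hrS.2.1]; exact hlt)))
    · obtain ⟨m, hm, h1, h2, h3, -⟩ := hxr.exists_lt_mem hlt hU hrU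
      obtain ⟨w, ⟨hwU, hw⟩, hwR⟩ := mem_closure_iff.1 hr (U ∩ Prod.snd ⁻¹' Ioi m.2)
        (hU.inter (isOpen_Ioi.preimage continuous_snd)) ⟨hrU, h2⟩
      exact hwR.2 (h3.trans (h m hm w ⟨hwU, hwR.1⟩ hw)).mem_reachSet
  have hlevel : ∀ t, IsClosed (reachSet Z x ∩ Prod.snd ⁻¹' {t}) := by
    intro t
    have hslice : IsClosed (Z ∩ Prod.snd ⁻¹' {t}) :=
      hZc.inter (isClosed_singleton.preimage continuous_snd)
    by_cases ht : t = x.2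
    · convert hSc using 1
      ext r
      constructor
      · rintro ⟨hr | hr, hrt⟩
        · exact hr
        · exact absurd (hrt.trans ht) hr.1.ne'
      · exact fun hr => ⟨hSsub hr, hr.2.1.trans ht.symm⟩
    · refine isClosed_of_closure_subset fun r hr => ?_
      have hr' := closure_minimal (inter_subset_inter_left _ reachSet_subset) hslice hr
      obtain ⟨U, hU, hrU, h⟩ := hreg' r (closure_mono inter_subset_left hr)
      obtain ⟨w, hwU, hwR, hwt⟩ := mem_closure_iff.1 hr U hU hrU
      have hwt : w.2 = t := hwt
      have hrt : r.2 = t := hr'.2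
      have hlt : x.2 < w.2 :=
        (hZx w (reachSet_subset hwR)).lt_of_ne fun he => ht (by rw [← hwt, ← he])
      have hxw := (mem_reachSet_iff_of_lt hlt).1 hwR
      obtain ⟨m, hm, -, h2, h3, -⟩ := hxw.exists_lt_mem hlt hU hwU
      exact ⟨(h3.trans (h m hm r ⟨hrU, hr'.1⟩ (by rw [hrt, ← hwt]; exact h2))).mem_reachSet, hr'.2⟩
  refine ⟨isClosed_of_closure_subset fun r hr => ?_, hopen⟩
  by_contra hrR
  have hrZ : r ∈ Z := closure_minimal reachSet_subset hZc hr
  obtain ⟨U, hU, hrU, h⟩ := hreg' r hr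
  -- The reachable part of the slice through `r` is clopen in that slice and misses `r`. A reachable
  -- point near `r` at the same or a later time would be connected to that part within the
  -- intervening times, which is excluded.
  have hsep := eventually_not_joined_of_slice_partition hZ (t₀ := r.2) (r := r)
    (T := reachSet Z x ∩ Prod.snd ⁻¹' {r.2}) (hlevel _) (by
      convert hopen.inter
        (isClosed_singleton.preimage continuous_snd : IsClosed (Prod.snd ⁻¹' {r.2})) using 1
      ext z
      simp only [mem_sdiff, mem_inter_iff]
      tauto) (inter_subset_left.trans reachSet_subset) ⟨⟨hrZ, rfl⟩, fun h => hrR h.1⟩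
  obtain ⟨w, ⟨hwU, hwsep⟩, hwR⟩ := mem_closure_iff_nhds.1 hr _
    (Filter.inter_mem (hU.mem_nhds hrU) hsep)
  have hwZ := reachSet_subset hwR
  rcases lt_or_ge w.2 r.2 with hlt | hge
  · exact hrR (Reach.trans_mem_reachSet hwR (h w ⟨hwU, hwZ⟩ r ⟨hrU, hrZ⟩ hlt))
  · obtain ⟨m, hmR, hmt, hmw⟩ : ∃ m ∈ reachSet Z x, m.2 = r.2 ∧ Reach Z m w := by
      rcases hwR with hwS | ⟨-, hxw⟩
      · refine ⟨w, .inl hwS, le_antisymm ?_ hge, Reach.refl hwZ⟩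
        rw [hwS.2.1]
        exact hZx r hrZ
      · obtain ⟨m, -, hmt, h1, h2⟩ := hxw.exists_mid ⟨hZx r hrZ, hge⟩
        exact ⟨m, h1.mem_reachSet, hmt, h2⟩
    obtain ⟨K, hKZ, hK, hmK, hwK, hlev⟩ := hmw.exists_isPreconnected
    refine hwsep m ⟨hmR, hmt⟩ K hKZ hK hmK hwK fun k hk => ?_
    rw [uIcc_of_le hge, ← hmt]
    exact hlev k hk

/-- Connected sets that meet the set of reachable points consist of reachable points, unless the
reachable points accumulate at a singular point. -/
theorem reach_of_isPreconnected (hZ : IsCompact Z) (hZx : ∀ z ∈ Z, x.2 ≤ z.2)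
    (hreg₀ : ∀ z ∈ Z, z.2 = x.2 → RegularAt Z z)
    (hreg : ∀ r ∈ closure {r | x.2 < r.2 ∧ Reach Z x r}, RegularAt Z r)
    {K : Set (E × ℝ)} (hK : IsPreconnected K) (hKZ : K ⊆ Z) (hq : q ∈ K) (hxq : Reach Z x q)
    (hr : r ∈ K) (hlt : x.2 < r.2) : Reach Z x r := by
  obtain ⟨h1, h2⟩ := isClosed_reachSet hZ hZx hreg₀ hreg
  rw [← mem_reachSet_iff_of_lt hlt]
  by_contra hrR
  obtain ⟨z, -, hz1, hz2⟩ := isPreconnected_closed_iff.1 hK _ _ h1 h2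
    (fun z hz => by by_cases h : z ∈ reachSet Z x; exacts [.inl h, .inr ⟨hKZ hz, h⟩])
    ⟨q, hq, hxq.mem_reachSet⟩ ⟨r, hr, hKZ hr, hrR⟩
  exact hz2.2 hz1

end Reach

/-! ### Passing a single singular point -/

section Singular

variable {E : Type*} [NormedAddCommGroup E] {Z Z' : Set (E × ℝ)}
  {p q r x y m : E × ℝ}

/-- Near `p`, the time slices of `Z` increase with time, and `p` lies in the interior of `Z` at
later times. -/
def OpensAt (Z : Set (E × ℝ)) (p : E × ℝ) : Prop :=
  ∃ ε > 0, (∀ x t t', dist x p.1 < ε → |t - p.2| < ε → |t' - p.2| < ε → t ≤ t' →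
    (x, t) ∈ Z → (x, t') ∈ Z) ∧ ∀ s, p.2 < s → s < p.2 + ε → Z ∈ 𝓝 (p.1, s)

/-- Near `p`, the time slices of `Z` decrease with time, and `p` lies in the interior of `Z` at
earlier times. -/
def ClosesAt (Z : Set (E × ℝ)) (p : E × ℝ) : Prop :=
  ∃ ε > 0, (∀ x t t', dist x p.1 < ε → |t - p.2| < ε → |t' - p.2| < ε → t' ≤ t →
    (x, t) ∈ Z → (x, t') ∈ Z) ∧ ∀ s, p.2 - ε < s → s < p.2 → Z ∈ 𝓝 (p.1, s)

theorem OpensAt.flip (h : OpensAt Z p) : ClosesAt (flipTime ⁻¹' Z) (flipTime p) := by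
  obtain ⟨ε, hε, h1, h2⟩ := h
  refine ⟨ε, hε, fun x t t' hx ht ht' hle hxt => ?_, fun s hs hs' => ?_⟩
  · refine h1 x (-t) (-t') hx ?_ ?_ (by linarith) hxt
    · rw [← abs_neg]; convert ht using 2; simp; ring
    · rw [← abs_neg]; convert ht' using 2; simp; ring
  · simp only [flipTime_snd] at hs hs'
    exact continuous_flipTime.continuousAt.preimage_mem_nhds
      (h2 (-s) (by linarith) (by linarith))

theorem ClosesAt.flip (h : ClosesAt Z p) : OpensAt (flipTime ⁻¹' Z) (flipTime p) := by
  obtain ⟨ε, hε, h1, h2⟩ := h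
  refine ⟨ε, hε, fun x t t' hx ht ht' hle hxt => ?_, fun s hs hs' => ?_⟩
  · refine h1 x (-t) (-t') hx ?_ ?_ (by linarith) hxt
    · rw [← abs_neg]; convert ht using 2; simp; ring
    · rw [← abs_neg]; convert ht' using 2; simp; ring
  · simp only [flipTime_snd] at hs hs'
    exact continuous_flipTime.continuousAt.preimage_mem_nhds
      (h2 (-s) (by linarith) (by linarith))

theorem exists_ball_prod_Ioo_subset {x : E} {s : ℝ} (h : Z ∈ 𝓝 (x, s)) :
    ∃ ρ > 0, Metric.ball x ρ ×ˢ Ioo (s - ρ) (s + ρ) ⊆ Z := by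
  obtain ⟨ρ, hρ, hsub⟩ := Metric.mem_nhds_iff.1 h
  refine ⟨ρ, hρ, ?_⟩
  rwa [← Real.ball_eq_Ioo, ball_prod_same]

theorem mem_nhds_ball_prod_Ioo (p : E × ℝ) {ε a b : ℝ} (hε : 0 < ε) (ha : a < p.2)
    (hb : p.2 < b) : Metric.ball p.1 ε ×ˢ Ioo a b ∈ 𝓝 p :=
  prod_mem_nhds (Metric.ball_mem_nhds _ hε) (Ioo_mem_nhds ha hb)

variable [NormedSpace ℝ E]

/-- In a set with a time-preserving convex parametrization, points at distinct times are joined by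
sections. -/
theorem reach_of_parametrization {V : Set (E × ℝ)} (hV : Convex ℝ V) {Ψ : E × ℝ → E × ℝ}
    {v v' : E × ℝ} (hv : v ∈ V) (hv' : v' ∈ V) (hlt : v.2 < v'.2)
    (hΨ : ContinuousOn Ψ V) (hΨZ : MapsTo Ψ V Z) (hΨt : ∀ w ∈ V, (Ψ w).2 = w.2) :
    Reach Z (Ψ v) (Ψ v') := by
  have e0 : (Ψ v).2 = v.2 := hΨt _ hv
  have e1 : (Ψ v').2 = v'.2 := hΨt _ hv'
  have hne : v'.2 - v.2 ≠ 0 := by linarith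
  let ℓ : ℝ → E × ℝ := fun s => AffineMap.lineMap v v' ((s - v.2) / (v'.2 - v.2))
  have hℓ : MapsTo ℓ (Icc v.2 v'.2) V := by
    intro s hs
    refine hV.lineMap_mem hv hv' ⟨div_nonneg (by linarith [hs.1]) (by linarith), ?_⟩
    rw [div_le_one (by linarith)]
    linarith [hs.2]
  have hℓc : Continuous ℓ := by
    refine AffineMap.lineMap_continuous.comp ?_
    fun_prop
  have hℓ0 : ℓ v.2 = v := by simp [ℓ]
  have hℓ1 : ℓ v'.2 = v' := by simp [ℓ, div_self hne]
  have hℓt : ∀ s, (ℓ s).2 = s := fun s => by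
    simp only [ℓ, AffineMap.lineMap_apply, vsub_eq_sub, vadd_eq_add, Prod.snd_add, Prod.smul_snd,
      Prod.snd_sub, smul_eq_mul]
    field_simp
    ring
  refine ⟨by rw [e0, e1]; exact hlt.le, fun s => (Ψ (ℓ s)).1, ?_, ?_, ?_, ?_⟩
  · rw [e0, e1]
    exact continuous_fst.comp_continuousOn (hΨ.comp hℓc.continuousOn hℓ)
  · rw [e0, e1]
    intro s hs
    have h2 : (Ψ (ℓ s)).2 = s := (hΨt _ (hℓ hs)).trans (hℓt s)
    have h3 := hΨZ (hℓ hs)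
    convert h3 using 1
    exact Prod.ext rfl h2.symm
  · simp only [e0, hℓ0]
  · simp only [e1, hℓ1]

theorem reach_of_convex_prod {V : Set E} (hV : Convex ℝ V) {v v' : E} {t t' : ℝ} (hv : v ∈ V)
    (hv' : v' ∈ V) (htt' : t < t') (hZ : V ×ˢ Icc t t' ⊆ Z) : Reach Z (v, t) (v', t') :=
  reach_of_parametrization (Ψ := id) (hV.prod (convex_Icc t t')) ⟨hv, left_mem_Icc.2 htt'.le⟩
    ⟨hv', right_mem_Icc.2 htt'.le⟩ htt' continuousOn_id hZ fun _ _ => rfl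

/-- A reachable point near `p` can wait in place, as the slices grow, until it is inside a product
neighbourhood of `(p.1, s)`; from there a straight segment finishes. -/
theorem OpensAt.exists_reach (h : OpensAt Z p)
    (hp : p ∈ closure {r | x.2 < r.2 ∧ Reach Z x r}) :
    ∃ δ > 0, ∀ s, p.2 < s → s < p.2 + δ → Reach Z x (p.1, s) := by
  obtain ⟨ε, hε, h1, h2⟩ := h
  refine ⟨ε, hε, fun s hs hs' => ?_⟩
  obtain ⟨ρ, hρ, hsub⟩ := exists_ball_prod_Ioo_subset (h2 s hs hs')
  obtain ⟨s₁, hs₁, hs₁'⟩ : ∃ s₁, max p.2 (s - ρ) < s₁ ∧ s₁ < s :=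
    exists_between (max_lt hs (by linarith))
  have hs₁p := (le_max_left _ _).trans_lt hs₁
  have hs₁ρ := (le_max_right _ _).trans_lt hs₁
  obtain ⟨r, ⟨hr1, hr2⟩, hxr, hr⟩ := mem_closure_iff_nhds.1 hp _
    (mem_nhds_ball_prod_Ioo p (lt_min hε hρ) (by linarith : p.2 - ε < p.2) hs₁p)
  rw [Metric.mem_ball, lt_min_iff] at hr1
  have hvert : Reach Z r (r.1, s₁) := by
    refine reach_of_convex_prod (convex_singleton r.1) rfl rfl hr2.2 ?_
    rintro ⟨z, t⟩ ⟨hz, ht⟩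
    rw [mem_singleton_iff] at hz
    simp only at hz ht
    subst hz
    refine h1 r.1 r.2 t hr1.1 ?_ ?_ ht.1 hr.right_mem <;> rw [abs_lt] <;>
      constructor <;> linarith [hr2.1, hr2.2, ht.1, ht.2]
  have hhor : Reach Z (r.1, s₁) (p.1, s) := by
    refine reach_of_convex_prod (convex_ball p.1 ρ) hr1.2 (Metric.mem_ball_self hρ) hs₁' ?_
    refine (prod_mono subset_rfl ?_).trans hsub
    exact fun t ht => ⟨by linarith [ht.1], by linarith [ht.2]⟩
  exact (hr.trans hvert).trans hhor

/-- The target is earlier than `p`, so the section to a point near `p` is not extended but rerouted.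
Below the time of `p` every point is regular, and connectedness already implies reachability there.
-/
theorem ClosesAt.exists_reach (h : ClosesAt Z p) (hZ : IsCompact Z) (hZx : ∀ z ∈ Z, x.2 ≤ z.2)
    (hxp : x.2 < p.2) (hreg : ∀ z ∈ Z, z ≠ p → RegularAt Z z)
    (hp : p ∈ closure {r | x.2 < r.2 ∧ Reach Z x r}) :
    ∃ δ > 0, ∀ s, p.2 - δ < s → s < p.2 → x.2 < s → Reach Z x (p.1, s) := by
  obtain ⟨ε, hε, h1, h2⟩ := h
  refine ⟨ε, hε, fun s hs hs' hxs => ?_⟩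
  have hZc := hZ.isClosed
  have hpZ : p ∈ Z := closure_minimal (fun r hr => hr.2.right_mem) hZc hp
  have hcompact : ∀ c, IsCompact (Z ∩ Prod.snd ⁻¹' Iic c) := fun c =>
    hZ.inter_right (isClosed_Iic.preimage continuous_snd)
  have hreach : ∀ {c q}, Reach Z x q → q.2 ≤ c → Reach (Z ∩ Prod.snd ⁻¹' Iic c) x q :=
    fun hq hc => hq.mono fun z hz hzt => ⟨hz, hzt.2.trans hc⟩
  have hreach' : ∀ {c q}, Reach (Z ∩ Prod.snd ⁻¹' Iic c) x q → Reach Z x q :=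
    fun hq => hq.mono fun z hz _ => hz.1
  have hregc : ∀ c, ∀ z ∈ Z ∩ Prod.snd ⁻¹' Iic c, z ≠ p →
      RegularAt (Z ∩ Prod.snd ⁻¹' Iic c) z := fun c z hz hzp =>
    (hreg z hz.1 hzp).inter_of_ordConnected ordConnected_Iic
  by_cases hcase : p ∈ closure {r | r.2 < p.2 ∧ x.2 < r.2 ∧ Reach Z x r}
  · obtain ⟨ρ, hρ, hsub⟩ := exists_ball_prod_Ioo_subset (h2 s hs hs')
    obtain ⟨r, ⟨hr1, hr2⟩, hrp, hxr, hr⟩ := mem_closure_iff_nhds.1 hcase _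
      (mem_nhds_ball_prod_Ioo p (lt_min hε hρ) hs' (by linarith : p.2 < p.2 + ε))
    rw [Metric.mem_ball, lt_min_iff] at hr1
    have hne : ∀ z ∈ Z ∩ Prod.snd ⁻¹' Iic r.2, z ≠ p := by
      rintro z hz rfl
      exact absurd hz.2 (not_le.2 hrp)
    -- Descend vertically from `r` to time `s`, then move horizontally inside a ball contained in
    -- the slice.
    have hK : IsPreconnected (({r.1} ×ˢ Icc s r.2) ∪ (Metric.ball p.1 ρ ×ˢ {s})) := by
      refine IsPreconnected.union (r.1, s) ⟨rfl, left_mem_Icc.2 hr2.1.le⟩ ⟨hr1.2, rfl⟩ ?_ ?_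
      · exact isPreconnected_singleton.prod isPreconnected_Icc
      · exact (convex_ball _ _).isPreconnected.prod isPreconnected_singleton
    refine hreach' (c := r.2) (reach_of_isPreconnected (hcompact _) (fun z hz => hZx z hz.1)
      (fun z hz _ => hregc _ z hz (hne z hz)) (fun z hz => ?_) hK ?_
      (q := r) (.inl ⟨rfl, right_mem_Icc.2 hr2.1.le⟩) (hreach hr le_rfl)
      (.inr ⟨Metric.mem_ball_self hρ, rfl⟩) hxs)
    · have hz' := closure_minimal (fun w hw => hw.2.right_mem) (hcompact _).isClosed hz
      exact hregc _ z hz' (hne z hz')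
    · rintro ⟨z, t⟩ (⟨hz, ht⟩ | ⟨hz, ht⟩)
      · rw [mem_singleton_iff] at hz
        simp only at hz ht
        subst hz
        refine ⟨h1 r.1 r.2 t hr1.1 ?_ ?_ ht.2 hr.right_mem, ht.2⟩ <;> rw [abs_lt] <;>
          constructor <;> linarith [hr2.1, hr2.2, ht.1, ht.2]
      · rw [mem_singleton_iff] at ht
        simp only at hz ht
        subst ht
        exact ⟨hsub ⟨hz, by linarith, by linarith⟩, hr2.1.le⟩
  -- If no reachable points accumulate at `p` from earlier times, none do up to the time of `p`, so
  -- the reachable set up to that time is clopen. Points near `p` reached later would pass through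
  -- its part of the slice of `p`, against the separation of slices.
  · exfalso
    have hnot : p ∉ closure {r | x.2 < r.2 ∧ Reach (Z ∩ Prod.snd ⁻¹' Iic p.2) x r} := by
      refine fun hp' => hcase (mem_closure_iff.2 fun U hU hpU => ?_)
      obtain ⟨r, hrU, hxr, hr⟩ := mem_closure_iff.1 hp' U hU hpU
      rcases (show r.2 ≤ p.2 from hr.right_mem.2).eq_or_lt with he | hlt
      · obtain ⟨m, hm, hm1, hm2, hm3, -⟩ := (hreach' hr).exists_lt_mem hxr hU hrU
        exact ⟨m, hm.1, he ▸ hm2, hm1, hm3⟩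
      · exact ⟨r, hrU, hlt, hxr, hreach' hr⟩
    obtain ⟨hc1, hc2⟩ := isClosed_reachSet (hcompact p.2) (x := x) (fun z hz => hZx z hz.1)
      (fun z hz hzx => hregc _ z hz (by rintro rfl; exact hxp.ne' hzx)) (fun z hz => by
        have hz' := closure_minimal (fun w hw => hw.2.right_mem) (hcompact _).isClosed hz
        exact hregc _ z hz' (by rintro rfl; exact hnot hz))
    set R := reachSet (Z ∩ Prod.snd ⁻¹' Iic p.2) x with hR
    have hpR : p ∉ R := fun hpR =>
      hnot (subset_closure ⟨hxp, (mem_reachSet_iff_of_lt hxp).1 hpR⟩)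
    have hlev : IsClosed (Prod.snd ⁻¹' {p.2} : Set (E × ℝ)) :=
      isClosed_singleton.preimage continuous_snd
    have hsep := eventually_not_joined_of_slice_partition hZ (t₀ := p.2) (r := p)
      (T := R ∩ Prod.snd ⁻¹' {p.2}) (hc1.inter hlev) (by
        convert hc2.inter hlev using 1
        ext z
        simp only [mem_sdiff, mem_inter_iff, mem_preimage, mem_Iic, mem_singleton_iff]
        constructor
        · rintro ⟨⟨hz, he⟩, h⟩
          exact ⟨⟨⟨hz, he.le⟩, fun h' => h ⟨h', he⟩⟩, he⟩
        · rintro ⟨⟨⟨hz, -⟩, h⟩, he⟩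
          exact ⟨⟨hz, he⟩, fun h' => h h'.1⟩)
      (inter_subset_left.trans (reachSet_subset.trans inter_subset_left))
      ⟨⟨hpZ, rfl⟩, fun h => hpR h.1⟩
    obtain ⟨w, ⟨hw1, hw2⟩, hxw, hw⟩ := mem_closure_iff_nhds.1 hp _
      (Filter.inter_mem hsep (isClosed_closure.isOpen_compl.mem_nhds hcase))
    have hge : p.2 ≤ w.2 := by
      by_contra hlt
      exact hw2 (subset_closure ⟨not_le.1 hlt, hxw, hw⟩)
    obtain ⟨m, -, hmt, hm1, hm2⟩ := hw.exists_mid ⟨hxp.le, hge⟩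
    obtain ⟨K, hKZ, hK, hmK, hwK, hKt⟩ := hm2.exists_isPreconnected
    refine hw1 m ⟨(hreach hm1 hmt.le).mem_reachSet, hmt⟩ K hKZ hK hmK hwK fun k hk => ?_
    rw [uIcc_of_le hge, ← hmt]
    exact hKt k hk

/-- If all points of the compact set `Z` but one are regular, and the time slices of `Z` open or
close at the exceptional point, then points of the initial and the final slice in the same component
of `Z` are joined by a section. -/
theorem reach_of_isPreconnected_of_subsingleton (hZ : IsCompact Z)
    (hZt : ∀ z ∈ Z, z.2 ∈ Icc x.2 y.2) (hxy : x.2 < y.2)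
    (hsing : {z ∈ Z | ¬ RegularAt Z z}.Subsingleton)
    (hmodel : ∀ z ∈ Z, ¬ RegularAt Z z → z.2 ∈ Ioo x.2 y.2 ∧ (OpensAt Z z ∨ ClosesAt Z z))
    {K : Set (E × ℝ)} (hK : IsPreconnected K) (hKZ : K ⊆ Z) (hx : x ∈ K) (hy : y ∈ K) :
    Reach Z x y := by
  by_contra hnot
  have hZc := hZ.isClosed
  have hflip : IsCompact (flipTime ⁻¹' Z) := by
    convert hZ.image continuous_flipTime using 1
    ext z
    exact ⟨fun h => ⟨_, h, by simp⟩, by rintro ⟨w, hw, rfl⟩; simpa using hw⟩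
  have hfsub : ∀ w : E × ℝ, ¬ RegularAt (flipTime ⁻¹' Z) w → ¬ RegularAt Z (flipTime w) :=
    fun w hw h => hw (by simpa using h.flip)
  -- Without a singular accumulation point the reachable set would be clopen and contain `y`. The
  -- same applies to the set reachable from `y` in reversed time.
  obtain ⟨p, hp, hpreg⟩ : ∃ p ∈ closure {r | x.2 < r.2 ∧ Reach Z x r}, ¬ RegularAt Z p := by
    by_contra! h
    refine hnot (reach_of_isPreconnected hZ (fun z hz => (hZt z hz).1) (fun z hz hzx => ?_) h hK hKZ
      hx (Reach.refl (hKZ hx)) hy hxy)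
    by_contra hz'
    exact (hmodel z hz hz').1.1.ne' hzx
  obtain ⟨p', hp', hpreg'⟩ : ∃ p' ∈ closure {r | (flipTime y).2 < r.2 ∧
      Reach (flipTime ⁻¹' Z) (flipTime y) r}, ¬ RegularAt (flipTime ⁻¹' Z) p' := by
    by_contra! h
    refine hnot (reach_flipTime_iff.1 (reach_of_isPreconnected hflip ?_ ?_ h
      (hK.image _ continuous_flipTime.continuousOn) ?_ ⟨y, hy, rfl⟩ (Reach.refl ?_)
      ⟨x, hx, rfl⟩ ?_))
    · intro z hz
      have := (hZt _ hz).2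
      simp at this ⊢
      linarith
    · intro z hz hzy
      by_contra hz'
      have := (hmodel _ hz (hfsub z hz')).1.2
      simp at this hzy
      linarith
    · rintro _ ⟨w, hw, rfl⟩
      simpa using hKZ hw
    · simpa using hKZ hy
    · simpa using hxy
  have hpZ : p ∈ Z := closure_minimal (fun r hr => hr.2.right_mem) hZc hp
  have hpZ' : p' ∈ flipTime ⁻¹' Z :=
    closure_minimal (fun r hr => hr.2.right_mem) hflip.isClosed hp'
  have hpp' : p' = flipTime p := by
    rw [hsing ⟨hpZ, hpreg⟩ ⟨hpZ', hfsub _ hpreg'⟩, flipTime_flipTime]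
  subst hpp'
  obtain ⟨⟨hxp, hpy⟩, hmod⟩ := hmodel p hpZ hpreg
  -- The sections meet on the vertical line through `p`, just after `p` if the region opens and just
  -- before if it closes. Time reversal exchanges the two models, so each case uses both
  -- `exists_reach` lemmas.
  suffices ∃ s, Reach Z x (p.1, s) ∧ Reach Z (p.1, s) y by
    obtain ⟨s, h1, h2⟩ := this
    exact hnot (h1.trans h2)
  rcases hmod with hmod | hmod
  · obtain ⟨δ, hδ, h1⟩ := hmod.exists_reach hp
    obtain ⟨δ', hδ', h2⟩ := hmod.flip.exists_reach hflip (fun z hz => by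
        have := (hZt _ hz).2
        simp at this ⊢
        linarith) (by simpa using hpy) (fun z hz hzp => by
        by_contra hz'
        apply hzp
        rw [hsing ⟨hpZ, hpreg⟩ ⟨hz, hfsub _ hz'⟩, flipTime_flipTime]) hp'
    obtain ⟨s, hs1, hs2⟩ := exists_between (show p.2 < min (min (p.2 + δ) (p.2 + δ')) y.2 from
      lt_min (lt_min (by linarith) (by linarith)) hpy)
    rw [lt_min_iff, lt_min_iff] at hs2
    refine ⟨s, h1 s hs1 hs2.1.1, ?_⟩
    rw [← reach_flipTime_iff]
    exact h2 (-s) (by simp; linarith) (by simpa using hs1) (by simpa using hs2.2)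
  · obtain ⟨δ, hδ, h1⟩ := hmod.exists_reach hZ (fun z hz => (hZt z hz).1) hxp (fun z hz hzp => by
        by_contra hz'
        exact hzp (hsing ⟨hz, hz'⟩ ⟨hpZ, hpreg⟩)) hp
    obtain ⟨δ', hδ', h2⟩ := hmod.flip.exists_reach hp'
    obtain ⟨s, hs1, hs2⟩ := exists_between (show max (max (p.2 - δ) (p.2 - δ')) x.2 < p.2 from
      max_lt (max_lt (by linarith) (by linarith)) hxp)
    rw [max_lt_iff, max_lt_iff] at hs1
    refine ⟨s, h1 s hs1.1.1 hs2 hs1.2, ?_⟩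
    rw [← reach_flipTime_iff]
    exact h2 (-s) (by simpa using hs2) (by simp; linarith)

end Singular

/-! ### Straightening charts -/

section Flat

variable {T : Type*} [NormedAddCommGroup T] [NormedSpace ℝ T]

/-- Pulling back a small ball of the chart gives arbitrarily small neighbourhoods whose trace on `Z`
is the image of a convex set, since convexity survives intersection with a ball. -/
theorem exists_isOpen_inter_eq_image {Z K : Set T} {q : T} (F : OpenPartialHomeomorph T T)
    (hq : q ∈ F.source) (hK : Convex ℝ K) (hZ : ∀ᶠ r in 𝓝 q, r ∈ Z ↔ F r ∈ K) {W : Set T}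
    (hW : W ∈ 𝓝 q) : ∃ U V, IsOpen U ∧ q ∈ U ∧ U ⊆ W ∧ U ⊆ F.source ∧ Convex ℝ V ∧
      V ⊆ F.target ∧ U ∩ Z = F.symm '' V := by
  obtain ⟨N, hN, hNo, hqN⟩ := mem_nhds_iff.1 (Filter.inter_mem hZ hW)
  have hO : IsOpen (F.target ∩ F.symm ⁻¹' N) := F.isOpen_inter_preimage_symm hNo
  obtain ⟨ρ, hρ, hball⟩ := Metric.isOpen_iff.1 hO (F q)
    ⟨F.map_source hq, by rw [mem_preimage, F.left_inv hq]; exact hqN⟩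
  have hUN : F.source ∩ F ⁻¹' Metric.ball (F q) ρ ⊆ N := fun r hr => by
    have := (hball hr.2).2
    rwa [mem_preimage, F.left_inv hr.1] at this
  refine ⟨F.source ∩ F ⁻¹' Metric.ball (F q) ρ, K ∩ Metric.ball (F q) ρ,
    F.isOpen_inter_preimage Metric.isOpen_ball, ⟨hq, Metric.mem_ball_self hρ⟩,
    fun r hr => (hN (hUN hr)).2, inter_subset_left, hK.inter (convex_ball _ _),
    fun w hw => (hball hw.2).1, ?_⟩
  ext r
  constructor
  · rintro ⟨hr, hrZ⟩
    exact ⟨F r, ⟨(hN (hUN hr)).1.1 hrZ, hr.2⟩, F.left_inv hr.1⟩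
  · rintro ⟨w, ⟨hwK, hwb⟩, rfl⟩
    have hwt := (hball hwb).1
    refine ⟨⟨F.map_target hwt, ?_⟩, ?_⟩
    · rw [mem_preimage, F.right_inv hwt]; exact hwb
    · refine (hN (hball hwb).2).1.2 ?_
      rwa [F.right_inv hwt]

/-- Near `q`, the set `Z` is homeomorphic to a convex set. -/
def FlatAt (Z : Set T) (q : T) : Prop :=
  ∃ F : OpenPartialHomeomorph T T, q ∈ F.source ∧ ∃ K, Convex ℝ K ∧ ∀ᶠ r in 𝓝 q, r ∈ Z ↔ F r ∈ K

theorem locallyPathConnectedSpace_of_flatAt {Z : Set T} (h : ∀ q ∈ Z, FlatAt Z q) :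
    LocallyPathConnectedSpace Z where
  path_connected_basis := by
    rintro ⟨q, hqZ⟩
    rw [Filter.hasBasis_self]
    intro S hS
    obtain ⟨W, hW, hWS⟩ := mem_nhds_subtype Z _ _ |>.1 hS
    obtain ⟨F, hq, K, hK, hZ⟩ := h q hqZ
    obtain ⟨U, V, hU, hqU, hUW, -, hV, hVt, hUZ⟩ := exists_isOpen_inter_eq_image F hq hK hZ hW
    refine ⟨Subtype.val ⁻¹' U, (hU.preimage continuous_subtype_val).mem_nhds hqU, ?_,
      (preimage_mono hUW).trans hWS⟩
    rw [Topology.IsInducing.subtypeVal.isPathConnected_iff, Subtype.image_preimage_coe, inter_comm,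
      hUZ]
    refine (hV.isPathConnected ?_).image' (F.continuousOn_symm.mono hVt)
    have : (F.symm '' V).Nonempty := hUZ ▸ ⟨q, hqU, hqZ⟩
    exact this.of_image

/-- The map `r ↦ r + (h r - h' r) w` straightens the level sets of `h`. -/
theorem exists_straightening [CompleteSpace T] {h : T → ℝ} {h' : T →L[ℝ] ℝ} {p : T}
    (hh : HasStrictFDerivAt h h' p) {w : T} (hw : h' w = 1) :
    ∃ F : OpenPartialHomeomorph T T, p ∈ F.source ∧ (∀ r, h' (F r) = h r) ∧
      ∀ r, F r = r + (h r - h' r) • w := by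
  -- The correction term has zero derivative at `p`, so the inverse function theorem applies with
  -- derivative the identity. For horizontal `w` the map preserves time.
  have hΦ : HasStrictFDerivAt (fun r => r + (h r - h' r) • w)
      ((ContinuousLinearEquiv.refl ℝ T : T ≃L[ℝ] T) : T →L[ℝ] T) p := by
    convert (hasStrictFDerivAt_id p).add ((hh.sub h'.hasStrictFDerivAt).smul_const w) using 1
    · rfl
    · rw [sub_self]
      ext v
      simp
  refine ⟨hΦ.toOpenPartialHomeomorph _, hΦ.mem_toOpenPartialHomeomorph_source, fun r => ?_,
    fun r => rfl⟩
  simp [hw]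

end Flat

/-! ### Time-preserving flat charts, and the opening and closing models. -/

section TimeFlat

variable {E : Type*} [NormedAddCommGroup E] [NormedSpace ℝ E] {Z : Set (E × ℝ)} {q : E × ℝ}

/-- Near `q`, the set `Z` is homeomorphic to a convex set by a time-preserving homeomorphism. -/
def TimeFlatAt (Z : Set (E × ℝ)) (q : E × ℝ) : Prop :=
  ∃ F : OpenPartialHomeomorph (E × ℝ) (E × ℝ), q ∈ F.source ∧ (∀ r, (F r).2 = r.2) ∧
    ∃ K, Convex ℝ K ∧ ∀ᶠ r in 𝓝 q, r ∈ Z ↔ F r ∈ K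

theorem TimeFlatAt.flatAt (h : TimeFlatAt Z q) : FlatAt Z q := by
  obtain ⟨F, hq, -, h⟩ := h
  exact ⟨F, hq, h⟩

theorem TimeFlatAt.inter (h : TimeFlatAt Z q) {J : Set ℝ} (hJ : Convex ℝ J) :
    TimeFlatAt (Z ∩ Prod.snd ⁻¹' J) q := by
  obtain ⟨F, hq, hF, K, hK, h⟩ := h
  refine ⟨F, hq, hF, K ∩ Prod.snd ⁻¹' J,
    hK.inter (hJ.linear_preimage (LinearMap.snd ℝ E ℝ)), h.mono fun r hr => ?_⟩
  simp [hr, hF]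

/-- Segments of the convex model with increasing time pull back to sections. -/
theorem TimeFlatAt.regularAt (h : TimeFlatAt Z q) : RegularAt Z q := by
  obtain ⟨F, hq, hF, K, hK, h⟩ := h
  obtain ⟨U, V, hU, hqU, -, hUs, hV, hVt, hUZ⟩ :=
    exists_isOpen_inter_eq_image F hq hK h Filter.univ_mem
  refine ⟨U, hU, hqU, fun r hr r' hr' hlt => ?_⟩
  have key : ∀ w ∈ V, (F.symm w).2 = w.2 := fun w hw => by rw [← hF, F.right_inv (hVt hw)]
  rw [hUZ] at hr hr'
  obtain ⟨v, hv, rfl⟩ := hr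
  obtain ⟨v', hv', rfl⟩ := hr'
  rw [key v hv, key v' hv'] at hlt
  refine reach_of_parametrization hV hv hv' hlt (F.continuousOn_symm.mono hVt) ?_ key
  rw [mapsTo_iff_image_subset, ← hUZ]
  exact inter_subset_right

theorem timeFlatAt_of_mem_iff {J : Set ℝ} (hJ : Convex ℝ J) (h : ∀ᶠ r in 𝓝 q, r ∈ Z ↔ r.2 ∈ J) :
    TimeFlatAt Z q :=
  ⟨OpenPartialHomeomorph.refl _, mem_univ _, fun _ => rfl, Prod.snd ⁻¹' J,
    hJ.linear_preimage (LinearMap.snd ℝ E ℝ), h⟩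

/-- A set cut out by a convex condition on a function with nonzero horizontal derivative. -/
theorem timeFlatAt_of_hasStrictFDerivAt [CompleteSpace E] {h : E × ℝ → ℝ} {h' : E × ℝ →L[ℝ] ℝ}
    (hh : HasStrictFDerivAt h h' q) {v : E} (hv : h' (v, 0) ≠ 0) {A J : Set ℝ} (hA : Convex ℝ A)
    (hJ : Convex ℝ J) (hZ : ∀ᶠ r in 𝓝 q, r ∈ Z ↔ h r ∈ A ∧ r.2 ∈ J) : TimeFlatAt Z q := by
  have hw : h' ((h' (v, 0))⁻¹ • v, 0) = 1 := by
    have : (((h' (v, 0))⁻¹ • v, 0) : E × ℝ) = (h' (v, 0))⁻¹ • (v, 0) := by simp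
    rw [this, map_smul, smul_eq_mul, inv_mul_cancel₀ hv]
  obtain ⟨F, hq, hF, hF'⟩ := exists_straightening hh hw
  have hFt : ∀ r, (F r).2 = r.2 := fun r => by simp [hF']
  refine ⟨F, hq, hFt, h' ⁻¹' A ∩ Prod.snd ⁻¹' J,
    (hA.linear_preimage h'.toLinearMap).inter (hJ.linear_preimage (LinearMap.snd ℝ E ℝ)),
    hZ.mono fun r hr => ?_⟩
  simp [hr, hF, hFt]

theorem flatAt_of_hasStrictFDerivAt {T : Type*} [NormedAddCommGroup T] [NormedSpace ℝ T]
    [CompleteSpace T] {Z : Set T} {q : T} {h : T → ℝ} {h' : T →L[ℝ] ℝ}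
    (hh : HasStrictFDerivAt h h' q) (hne : h' ≠ 0) {A : Set ℝ} (hA : Convex ℝ A)
    (hZ : ∀ᶠ r in 𝓝 q, r ∈ Z ↔ h r ∈ A) : FlatAt Z q := by
  obtain ⟨w, hw⟩ : ∃ w, h' w ≠ 0 := by
    by_contra! hcon
    exact hne (ContinuousLinearMap.ext hcon)
  obtain ⟨F, hq, hF, -⟩ := exists_straightening hh (w := (h' w)⁻¹ • w)
    (by rw [map_smul, smul_eq_mul, inv_mul_cancel₀ hw])
  exact ⟨F, hq, h' ⁻¹' A, hA.linear_preimage h'.toLinearMap, hZ.mono fun r hr => by simp [hr, hF]⟩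

theorem opensAt_of_strictAnti {E : Type*} [NormedAddCommGroup E] {Z : Set (E × ℝ)}
    {h : E × ℝ → ℝ} {p : E × ℝ} (hp : h p = 0)
    (hcont : ∀ᶠ r in 𝓝 p, ContinuousAt h r) (hZ : ∀ᶠ r in 𝓝 p, r ∈ Z ↔ h r ≤ 0)
    (hmono : ∀ᶠ s in 𝓝 (p, p), s.1.1 = s.2.1 → s.1.2 < s.2.2 → h s.2 < h s.1) :
    OpensAt Z p := by
  obtain ⟨ε, hε, hball⟩ := Metric.eventually_nhds_iff_ball.1 (hcont.and hZ)
  obtain ⟨ε', hε', hball'⟩ := Metric.eventually_nhds_iff_ball.1 hmono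
  have hmem : ∀ x t, dist x p.1 < min ε ε' → |t - p.2| < min ε ε' →
      (x, t) ∈ Metric.ball p ε ∧ (x, t) ∈ Metric.ball p ε' := by
    intro x t hx ht
    rw [lt_min_iff] at hx ht
    constructor <;> rw [Metric.mem_ball, Prod.dist_eq, max_lt_iff]
    · exact ⟨hx.1, ht.1⟩
    · exact ⟨hx.2, ht.2⟩
  have hlt : ∀ x t t', dist x p.1 < min ε ε' → |t - p.2| < min ε ε' → |t' - p.2| < min ε ε' →
      t < t' → h (x, t') < h (x, t) := by
    intro x t t' hx ht ht' htt'
    refine hball' ((x, t), (x, t')) ?_ rfl htt'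
    rw [← ball_prod_same]
    exact ⟨(hmem x t hx ht).2, (hmem x t' hx ht').2⟩
  have hpos : 0 < min ε ε' := lt_min hε hε'
  refine ⟨min ε ε', hpos, fun x t t' hx ht ht' hle hxt => ?_, fun s hs hs' => ?_⟩
  · rcases hle.eq_or_lt with rfl | hlt'
    · exact hxt
    · have h1 := (hball _ (hmem x t hx ht).1).2.1 hxt
      exact (hball _ (hmem x t' hx ht').1).2.2 ((hlt x t t' hx ht ht' hlt').le.trans h1)
  · have hs0 : |s - p.2| < min ε ε' := by rw [abs_lt]; constructor <;> linarith
    have h0 : dist p.1 p.1 < min ε ε' := by simpa using hpos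
    have hsb := (hmem p.1 s h0 hs0).1
    have h1 : h (p.1, s) < 0 := by
      have := hlt p.1 p.2 s h0 (by simpa using hpos) hs0 hs
      rwa [Prod.mk.eta, hp] at this
    have h2 : ∀ᶠ r in 𝓝 (p.1, s), h r < 0 := (hball _ hsb).1.eventually (gt_mem_nhds h1)
    filter_upwards [h2, Metric.isOpen_ball.mem_nhds hsb] with r hr hrb
    exact (hball r hrb).2.2 hr.le

theorem HasStrictFDerivAt.eventually_strictAnti {h : E × ℝ → ℝ} {h' : E × ℝ →L[ℝ] ℝ} {p : E × ℝ}
    (hh : HasStrictFDerivAt h h' p) (hneg : h' (0, 1) < 0) :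
    ∀ᶠ s in 𝓝 (p, p), s.1.1 = s.2.1 → s.1.2 < s.2.2 → h s.2 < h s.1 := by
  -- An error of at most half the vertical slope preserves the sign of the increment, uniformly over
  -- vertical pairs near `p`.
  have hb := hh.isLittleO.def (c := -h' (0, 1) / 2) (by linarith)
  filter_upwards [hb] with s hs h1 h2
  have e : s.1 - s.2 = (s.1.2 - s.2.2) • ((0, 1) : E × ℝ) := by
    ext <;> simp [h1]
  have hn : ‖s.1 - s.2‖ = s.2.2 - s.1.2 := by
    rw [Prod.norm_def]
    simp only [Prod.fst_sub, Prod.snd_sub, h1, sub_self, norm_zero, Real.norm_eq_abs]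
    rw [max_eq_right (abs_nonneg _), abs_sub_comm, abs_of_pos (by linarith)]
  rw [hn, e, map_smul, smul_eq_mul, Real.norm_eq_abs] at hs
  have := (abs_le.1 hs).1
  nlinarith

theorem opensAt_of_hasStrictFDerivAt {h : E × ℝ → ℝ} {h' : E × ℝ →L[ℝ] ℝ} {p : E × ℝ}
    (hh : HasStrictFDerivAt h h' p) (hneg : h' (0, 1) < 0) (hp : h p = 0)
    (hcont : ∀ᶠ r in 𝓝 p, ContinuousAt h r) (hZ : ∀ᶠ r in 𝓝 p, r ∈ Z ↔ h r ≤ 0) :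
    OpensAt Z p :=
  opensAt_of_strictAnti hp hcont hZ (HasStrictFDerivAt.eventually_strictAnti hh hneg)

theorem closesAt_of_hasStrictFDerivAt {h : E × ℝ → ℝ} {h' : E × ℝ →L[ℝ] ℝ} {p : E × ℝ}
    (hh : HasStrictFDerivAt h h' p) (hpos : 0 < h' (0, 1)) (hp : h p = 0)
    (hcont : ∀ᶠ r in 𝓝 p, ContinuousAt h r) (hZ : ∀ᶠ r in 𝓝 p, r ∈ Z ↔ h r ≤ 0) :
    ClosesAt Z p := by
  let φ : (E × ℝ) →L[ℝ] (E × ℝ) :=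
    (ContinuousLinearMap.fst ℝ E ℝ).prod (-ContinuousLinearMap.snd ℝ E ℝ)
  have hφ : ∀ r, φ r = flipTime r := fun r => by simp [φ, flipTime]
  have hflip : Filter.Tendsto flipTime (𝓝 (flipTime p)) (𝓝 p) := by
    simpa using (continuous_flipTime (E := E)).tendsto (flipTime p)
  have hh' : HasStrictFDerivAt h h' (φ (flipTime p)) := by simpa [hφ] using hh
  have hopen : OpensAt (flipTime ⁻¹' Z) (flipTime p) := by
    refine opensAt_of_hasStrictFDerivAt (h := h ∘ φ) (hh'.comp _ φ.hasStrictFDerivAt) ?_ ?_ ?_ ?_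
    · have : φ (0, 1) = -(0, 1) := by simp [φ]
      rw [ContinuousLinearMap.comp_apply, this, map_neg]
      linarith
    · simpa [hφ] using hp
    · filter_upwards [hflip.eventually hcont] with r hr
      exact ContinuousAt.comp (by rwa [hφ]) φ.continuous.continuousAt
    · filter_upwards [hflip.eventually hZ] with r hr
      simpa [hφ] using hr
  simpa [preimage_flipTime_preimage_flipTime] using hopen.flip

end TimeFlat

/-! ### Local models of covered regions -/

/-- A function which is nonnegative on the quadrant `0 ≤ a`, `0 ≤ ℓ` and vanishes there exactly on
the face `a = 0` has the same sign as `a` where `0 ≤ ℓ`. -/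
theorem exists_pos_smul_and_sign_iff {V : Type*} [NormedAddCommGroup V] [NormedSpace ℝ V]
    {a ℓ : V →L[ℝ] ℝ} {u y₀ : V} (hau : a u = 1) (hℓu : ℓ u = 0) (ha₀ : a y₀ = 0) (hℓ₀ : ℓ y₀ = 0)
    {T : V → ℝ} {T' : V →L[ℝ] ℝ} (hT : HasStrictFDerivAt T T' y₀) (hT' : T' ≠ 0)
    (h : ∀ᶠ y in 𝓝 y₀, 0 ≤ ℓ y → 0 ≤ a y → 0 ≤ T y ∧ (T y = 0 ↔ a y = 0)) :
    ∃ c : ℝ, 0 < c ∧ T' = c • a ∧ ∀ᶠ y in 𝓝 y₀, 0 ≤ ℓ y → (0 ≤ T y ↔ 0 ≤ a y) := by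
  have hline : ∀ w : V, ∀ᶠ s in 𝓝[>] (0 : ℝ), 0 ≤ ℓ (y₀ + s • w) → 0 ≤ a (y₀ + s • w) →
      0 ≤ T (y₀ + s • w) ∧ (T (y₀ + s • w) = 0 ↔ a (y₀ + s • w) = 0) := by
    intro w
    have : Filter.Tendsto (fun s : ℝ => y₀ + s • w) (𝓝[>] 0) (𝓝 y₀) := by
      have hc : Continuous fun s : ℝ => y₀ + s • w := by fun_prop
      have := hc.tendsto 0
      simp only [zero_smul, add_zero] at this
      exact this.mono_left nhdsWithin_le_nhds
    exact this.eventually h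
  have hT₀ : T y₀ = 0 := ((h.self_of_nhds hℓ₀.ge ha₀.ge).2).2 ha₀
  -- `T` vanishes along rays that stay in the face, so its one-sided derivative there is zero; the
  -- opposite rays follow by linearity.
  have hker : ∀ w, a w = 0 → 0 ≤ ℓ w → T' w = 0 := by
    intro w haw hℓw
    have hd : HasDerivAt (fun s : ℝ => T (y₀ + s • w)) (T' w) 0 := by
      have h1 : HasDerivAt (fun s : ℝ => y₀ + s • w) w 0 := by
        simpa using ((hasDerivAt_id (0 : ℝ)).smul_const w).const_add y₀
      have h2 : HasFDerivAt T T' (y₀ + (0 : ℝ) • w) := by simpa using hT.hasFDerivAt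
      exact h2.comp_hasDerivAt 0 h1
    have hz : HasDerivWithinAt (fun s : ℝ => T (y₀ + s • w)) 0 (Ioi 0) 0 := by
      refine (hasDerivWithinAt_const (0 : ℝ) (Ioi 0) (0 : ℝ)).congr_of_eventuallyEq ?_
        (by simpa using hT₀)
      filter_upwards [hline w, self_mem_nhdsWithin] with s hs hs0
      have hs0 : 0 < s := hs0
      have e1 : a (y₀ + s • w) = 0 := by simp [ha₀, haw]
      exact (hs (by simp [hℓ₀]; positivity) e1.ge).2.2 e1
    exact (uniqueDiffWithinAt_Ioi (0 : ℝ)).eq_deriv _ hd.hasDerivWithinAt hz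
  have hker' : ∀ w, a w = 0 → T' w = 0 := by
    intro w haw
    rcases le_total 0 (ℓ w) with hℓ | hℓ
    · exact hker w haw hℓ
    · have := hker (-w) (by simp [haw]) (by simpa using hℓ)
      simpa using this
  have hsmul : T' = T' u • a := by
    ext w
    have := hker' (w - a w • u) (by simp [hau])
    simp only [map_sub, map_smul, smul_eq_mul] at this
    simp only [FunLike.coe_smul, Pi.smul_apply, smul_eq_mul]
    linarith
  set c := T' u with hc
  have hc0 : c ≠ 0 := fun h0 => hT' (by rw [hsmul, h0, zero_smul])
  have hu : u ≠ 0 := by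
    rintro rfl
    simp at hau
  have hun : 0 < ‖u‖ := norm_pos_iff.2 hu
  -- The point `y - a y • u` is the projection of `y` to the face along `u`; it keeps the value of
  -- `ℓ`, and `T` vanishes there. Strict differentiability compares the two points.
  have hmap : Filter.Tendsto (fun y => (y, y - a y • u)) (𝓝 y₀) (𝓝 (y₀, y₀)) := by
    have hcont : Continuous fun y => (y, y - a y • u) := by fun_prop
    simpa [ha₀] using hcont.tendsto y₀
  have hbound : ∀ᶠ y in 𝓝 y₀, 0 ≤ ℓ y → |T y - c * a y| ≤ |c| / 2 * |a y| := by
    have hb := hmap.eventually (hT.isLittleO.def (c := |c| / (2 * ‖u‖)) (by positivity))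
    have hp := (continuous_snd.tendsto _).comp hmap |>.eventually h
    filter_upwards [hb, hp] with y hy hy' hℓ
    simp only [Function.comp_apply, map_sub, map_smul, hℓu, hau, smul_eq_mul, mul_zero, sub_zero,
      mul_one, sub_self] at hy'
    have hz := (hy' hℓ le_rfl).2.2 trivial
    simp only [hz, sub_zero, sub_sub_cancel, map_smul, smul_eq_mul, norm_smul, ← hc,
      Real.norm_eq_abs] at hy
    calc |T y - c * a y| = |T y - a y * c| := by rw [mul_comm]
      _ ≤ |c| / (2 * ‖u‖) * (|a y| * ‖u‖) := hy
      _ = |c| / 2 * |a y| := by field_simp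
  have hcpos : 0 < c := by
    by_contra hneg
    have hneg : c < 0 := lt_of_le_of_ne (not_lt.1 hneg) hc0
    have htend : Filter.Tendsto (fun s : ℝ => y₀ + s • u) (𝓝[>] 0) (𝓝 y₀) := by
      have hcont : Continuous fun s : ℝ => y₀ + s • u := by fun_prop
      have := hcont.tendsto 0
      simp only [zero_smul, add_zero] at this
      exact this.mono_left nhdsWithin_le_nhds
    obtain ⟨s, ⟨hs1, hs2⟩, hs0⟩ :=
      ((hline u).and (htend.eventually hbound) |>.and self_mem_nhdsWithin).exists
    have hs0 : 0 < s := hs0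
    have e1 : a (y₀ + s • u) = s := by simp [ha₀, hau]
    have e2 : ℓ (y₀ + s • u) = 0 := by simp [hℓ₀, hℓu]
    rw [e1, e2] at hs1 hs2
    have h1 := (hs1 le_rfl hs0.le).1
    have h2 := (abs_le.1 (hs2 le_rfl)).2
    rw [abs_of_neg hneg, abs_of_pos hs0] at h2
    nlinarith
  refine ⟨c, hcpos, hsmul, hbound.mono fun y hy hℓ => ?_⟩
  have hy := abs_le.1 (hy hℓ)
  rw [abs_of_pos hcpos] at hy
  constructor
  · intro hTy
    by_contra hneg
    rw [abs_of_neg (not_le.1 hneg)] at hy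
    nlinarith [hy.2, not_le.1 hneg]
  · intro hay
    rw [abs_of_nonneg hay] at hy
    nlinarith [hy.1]

section Chart

variable {d : ℕ} {e : OpenPartialHomeomorph (SpaceTime d) (Space (d + 1))} {p : SpaceTime d}

theorem IsSmoothChart.contDiffAt (he : IsSmoothChart e) (hp : p ∈ e.source) :
    ContDiffAt ℝ 1 e p :=
  (he.1.contDiffAt (e.open_source.mem_nhds hp)).of_le (by simp)

theorem IsSmoothChart.contDiffAt_symm (he : IsSmoothChart e) (hp : p ∈ e.source) :
    ContDiffAt ℝ 1 e.symm (e p) :=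
  (he.2.contDiffAt (e.open_target.mem_nhds (e.map_source hp))).of_le (by simp)

theorem IsSmoothChart.fderiv_fderiv_symm (he : IsSmoothChart e) (hp : p ∈ e.source)
    (w : Space (d + 1)) : fderiv ℝ e p (fderiv ℝ e.symm (e p) w) = w := by
  have h1 := ((he.contDiffAt hp).differentiableAt one_ne_zero).hasFDerivAt
  have h2 := ((he.contDiffAt_symm hp).differentiableAt one_ne_zero).hasFDerivAt
  rw [← e.left_inv hp] at h1
  have h3 := h1.comp (e p) h2
  rw [e.left_inv hp] at h3
  have h4 : HasFDerivAt (e ∘ e.symm) (ContinuousLinearMap.id ℝ _) (e p) := by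
    refine (hasFDerivAt_id (e p)).congr_of_eventuallyEq ?_
    filter_upwards [e.open_target.mem_nhds (e.map_source hp)] with y hy
    exact e.right_inv hy
  exact congrArg (· w) (h3.unique h4)

theorem IsSmoothChart.fderiv_symm_fderiv (he : IsSmoothChart e) (hp : p ∈ e.source)
    (w : SpaceTime d) : fderiv ℝ e.symm (e p) (fderiv ℝ e p w) = w := by
  have h1 := ((he.contDiffAt hp).differentiableAt one_ne_zero).hasFDerivAt
  have h2 := ((he.contDiffAt_symm hp).differentiableAt one_ne_zero).hasFDerivAt
  have h3 := h2.comp p h1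
  have h4 : HasFDerivAt (e.symm ∘ e) (ContinuousLinearMap.id ℝ _) p := by
    refine (hasFDerivAt_id p).congr_of_eventuallyEq ?_
    filter_upwards [e.open_source.mem_nhds hp] with y hy
    exact e.left_inv hy
  exact congrArg (· w) (h3.unique h4)

theorem IsSmoothChart.contDiffAt_coord (he : IsSmoothChart e) (hp : p ∈ e.source)
    (i : Fin (d + 1)) : ContDiffAt ℝ 1 (fun r => e r i) p :=
  (EuclideanSpace.proj (𝕜 := ℝ) i).contDiff.contDiffAt.comp p (he.contDiffAt hp)

theorem IsSmoothChart.fderiv_coord (he : IsSmoothChart e) (hp : p ∈ e.source)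
    (i : Fin (d + 1)) (w : SpaceTime d) :
    fderiv ℝ (fun r => e r i) p w = (fderiv ℝ e p w) i := by
  have h1 := ((he.contDiffAt hp).differentiableAt one_ne_zero).hasFDerivAt
  have h2 := (EuclideanSpace.proj (𝕜 := ℝ) i : Space (d + 1) →L[ℝ] ℝ).hasFDerivAt.comp p h1
  exact congrArg (· w) h2.fderiv

theorem IsFacePoint.exists_function {M F : Set (SpaceTime d)} (h : IsFacePoint M F p) :
    ∃ h : SpaceTime d → ℝ, ContDiffAt ℝ 1 h p ∧ fderiv ℝ h p ≠ 0 ∧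
      ∀ᶠ r in 𝓝 p, (r ∈ M ↔ 0 ≤ h r) ∧ (r ∈ F ↔ h r = 0) := by
  obtain ⟨e, he, hp, -, hM, hF⟩ := h
  refine ⟨fun r => e r 0, he.contDiffAt_coord hp 0, fun h0 => ?_, ?_⟩
  · have h1 := he.fderiv_coord hp 0 (fderiv ℝ e.symm (e p) (EuclideanSpace.single 0 1))
    rw [he.fderiv_fderiv_symm hp, h0] at h1
    simp at h1
  · filter_upwards [e.open_source.mem_nhds hp] with r hr
    have h1 := Set.ext_iff.1 hM r
    have h2 := Set.ext_iff.1 hF r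
    simp only [mem_inter_iff, hr, true_and, mem_ofPred_eq] at h1 h2
    exact ⟨h1, h2⟩

/-- Charts whose zeroth coordinate vanishes on `τ = 0` can be adapted to the time function `τ`. -/
theorem IsSmoothChart.sign_iff (he : IsSmoothChart e) (hp : p ∈ e.source)
    {ℓ : Space (d + 1) →L[ℝ] ℝ} (hℓ : ℓ (EuclideanSpace.single 0 1) = 0) (h0 : e p 0 = 0)
    (hℓ0 : ℓ (e p) = 0) {τ : SpaceTime d → ℝ} {τ' : SpaceTime d →L[ℝ] ℝ}
    (hτ : HasStrictFDerivAt τ τ' p) (hτ' : τ' ≠ 0)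
    (h : ∀ r ∈ e.source, 0 ≤ ℓ (e r) → 0 ≤ e r 0 → 0 ≤ τ r ∧ (τ r = 0 ↔ e r 0 = 0)) :
    (∃ c : ℝ, 0 < c ∧ ∀ w, τ' (fderiv ℝ e.symm (e p) w) = c * w 0) ∧
      ∀ᶠ r in 𝓝 p, 0 ≤ ℓ (e r) → (0 ≤ τ r ↔ 0 ≤ e r 0) := by
  have hstrict : HasStrictFDerivAt (τ ∘ e.symm) (τ'.comp (fderiv ℝ e.symm (e p))) (e p) := by
    refine HasStrictFDerivAt.comp (e p) ?_
      ((he.contDiffAt_symm hp).hasStrictFDerivAt one_ne_zero)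
    rwa [e.left_inv hp]
  have hne : τ'.comp (fderiv ℝ e.symm (e p)) ≠ 0 := by
    intro hz
    apply hτ'
    refine ContinuousLinearMap.ext fun w => ?_
    rw [← he.fderiv_symm_fderiv hp w]
    exact congrArg (· (fderiv ℝ e p w)) hz
  obtain ⟨c, hc, hc', hev⟩ := exists_pos_smul_and_sign_iff
    (a := EuclideanSpace.proj (𝕜 := ℝ) (0 : Fin (d + 1))) (u := EuclideanSpace.single 0 1)
    (by simp) hℓ h0 hℓ0 hstrict hne (by
      filter_upwards [e.open_target.mem_nhds (e.map_source hp)] with y hy h1 h2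
      have := h (e.symm y) (e.map_target hy)
      rw [e.right_inv hy] at this
      exact this h1 h2)
  refine ⟨⟨c, hc, fun w => ?_⟩, ?_⟩
  · have := congrArg (· w) hc'
    simpa using this
  · filter_upwards [(e.continuousAt hp).eventually hev, e.open_source.mem_nhds hp] with r hr hrs h1
    have := hr h1
    rwa [Function.comp_apply, e.left_inv hrs] at this

/-- Used at the bottom and top faces away from `N`: the covered region fills all nearby points with
time in `[0, 1]`, so such points are not limits of uncovered points. -/
theorem IsFacePoint.eventually_mem {M F : Set (SpaceTime d)} (h : IsFacePoint M F p)
    {τ : SpaceTime d → ℝ} {τ' : SpaceTime d →L[ℝ] ℝ} (hτ : HasStrictFDerivAt τ τ' p)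
    (hτ' : τ' ≠ 0) (hM : ∀ r ∈ M, 0 ≤ τ r) (hF : ∀ r, r ∈ F ↔ r ∈ M ∧ τ r = 0) :
    ∀ᶠ r in 𝓝 p, 0 ≤ τ r → r ∈ M := by
  obtain ⟨e, he, hp, h0, hMe, hFe⟩ := h
  have h1 : ∀ r ∈ e.source, (r ∈ M ↔ 0 ≤ e r 0) := fun r hr => by
    simpa [hr] using Set.ext_iff.1 hMe r
  have h2 : ∀ r ∈ e.source, (r ∈ F ↔ e r 0 = 0) := fun r hr => by
    simpa [hr] using Set.ext_iff.1 hFe r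
  obtain ⟨-, hev⟩ := he.sign_iff hp (ℓ := 0) (by simp) h0 (by simp) hτ hτ' (fun r hr _ hr0 => by
    have hrM := (h1 r hr).2 hr0
    refine ⟨hM r hrM, ?_⟩
    rw [← h2 r hr, hF]
    simp [hrM])
  filter_upwards [hev, e.open_source.mem_nhds hp] with r hr hrs hτr
  exact (h1 r hrs).2 ((hr (by simp)).1 hτr)

/-- The chart coordinate of the face `F` is traded for `τ`, and the other coordinate serves as `h`.
The coordinate direction of `h` is killed by `τ'`, as `τ'` is a multiple of the traded coordinate.
-/
theorem IsCornerPoint.exists_function (hd : d ≠ 0) {M F G : Set (SpaceTime d)}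
    (h : IsCornerPoint M F G p)
    {τ : SpaceTime d → ℝ} {τ' : SpaceTime d →L[ℝ] ℝ} (hτ : HasStrictFDerivAt τ τ' p)
    (hτ' : τ' ≠ 0) (hM : ∀ r ∈ M, 0 ≤ τ r) (hF : ∀ r, r ∈ F ↔ r ∈ M ∧ τ r = 0) :
    ∃ h : SpaceTime d → ℝ, ContDiffAt ℝ 1 h p ∧ (∃ w, τ' w = 0 ∧ fderiv ℝ h p w ≠ 0) ∧
      ∀ᶠ r in 𝓝 p, (r ∈ M ↔ 0 ≤ h r ∧ 0 ≤ τ r) ∧ (r ∈ G ↔ h r = 0 ∧ 0 ≤ τ r) := by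
  obtain ⟨e, he, hp, h0, h1, hMe, hFe, hGe⟩ := h
  -- For `d = 0` the two corner coordinates would coincide.
  have h01 : (1 : Fin (d + 1)) ≠ 0 := by
    obtain ⟨k, rfl⟩ := Nat.exists_eq_succ_of_ne_zero hd
    exact Fin.succ_ne_zero (0 : Fin (k + 1))
  have m1 : ∀ r ∈ e.source, (r ∈ M ↔ 0 ≤ e r 0 ∧ 0 ≤ e r 1) := fun r hr => by
    simpa [hr] using Set.ext_iff.1 hMe r
  have m2 : ∀ r ∈ e.source, (r ∈ F ↔ e r 0 = 0 ∧ 0 ≤ e r 1) := fun r hr => by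
    simpa [hr] using Set.ext_iff.1 hFe r
  have m3 : ∀ r ∈ e.source, (r ∈ G ↔ 0 ≤ e r 0 ∧ e r 1 = 0) := fun r hr => by
    simpa [hr] using Set.ext_iff.1 hGe r
  obtain ⟨⟨c, hc, hτe⟩, hev⟩ := he.sign_iff hp
    (ℓ := EuclideanSpace.proj (𝕜 := ℝ) (1 : Fin (d + 1))) (by simp [h01]) h0
    (by simpa using h1) hτ hτ' (fun r hr hr1 hr0 => by
      have hr1 : 0 ≤ e r 1 := by simpa using hr1
      have hrM := (m1 r hr).2 ⟨hr0, hr1⟩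
      refine ⟨hM r hrM, ?_⟩
      have h2 := m2 r hr
      rw [hF] at h2
      simpa [hrM, hr1] using h2)
  refine ⟨fun r => e r 1, he.contDiffAt_coord hp 1,
    ⟨fderiv ℝ e.symm (e p) (EuclideanSpace.single 1 1), ?_, ?_⟩, ?_⟩
  · rw [hτe]
    simp [h01.symm]
  · rw [he.fderiv_coord hp, he.fderiv_fderiv_symm hp]
    simp
  · filter_upwards [hev, e.open_source.mem_nhds hp] with r hr hrs
    have hr : 0 ≤ e r 1 → (0 ≤ τ r ↔ 0 ≤ e r 0) := by simpa using hr
    rw [m1 r hrs, m3 r hrs]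
    constructor
    · constructor
      · rintro ⟨a, b⟩
        exact ⟨b, (hr b).2 a⟩
      · rintro ⟨b, a⟩
        exact ⟨(hr b).1 a, b⟩
    · constructor
      · rintro ⟨a, b⟩
        exact ⟨b, (hr b.ge).2 a⟩
      · rintro ⟨b, a⟩
        exact ⟨(hr b.ge).1 a, b⟩

end Chart

/-! ### Geometry of covered regions -/

section CoveredRegion

variable {d : ℕ} {D : Set (Space d)} {C N : Set (SpaceTime d)} {p : SpaceTime d}

theorem IsSmoothBall.isCompact (hD : IsSmoothBall D) : IsCompact D := by
  obtain ⟨φ, hφ, -, -, rfl⟩ := hD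
  exact (isCompact_closedBall _ _).image hφ.continuous

theorem IsCoveredRegion.isClosed (hC : IsCoveredRegion D C N) : IsClosed C :=
  hC.isCobordism.isCompact.isClosed

theorem IsCoveredRegion.side_subset (hC : IsCoveredRegion D C N) : N ⊆ C := by
  have h : N ⊆ frontier C := by
    rw [hC.isCobordism.boundary_eq]
    exact fun p hp => .inl (.inr hp)
  exact h.trans hC.isClosed.frontier_subset

theorem IsCoveredRegion.wall_subset (hC : IsCoveredRegion D C N) :
    frontier D ×ˢ Icc 0 1 ⊆ N := by
  obtain ⟨p, -, hp⟩ := hC.wall_isComponent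
  rw [← hp]
  exact connectedComponentIn_subset _ _

theorem isClosed_wall (D : Set (Space d)) :
    IsClosed (frontier D ×ˢ Icc (0 : ℝ) 1) :=
  isClosed_frontier.prod isClosed_Icc

theorem hasStrictFDerivAt_snd_sub (p : SpaceTime d) (c : ℝ) :
    HasStrictFDerivAt (fun r : SpaceTime d => r.2 - c) (ContinuousLinearMap.snd ℝ (Space d) ℝ) p :=
  (hasStrictFDerivAt_snd (𝕜 := ℝ)).sub_const c

theorem hasStrictFDerivAt_sub_snd (p : SpaceTime d) (c : ℝ) :
    HasStrictFDerivAt (fun r : SpaceTime d => c - r.2) (-ContinuousLinearMap.snd ℝ (Space d) ℝ) p :=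
  (hasStrictFDerivAt_snd (𝕜 := ℝ)).const_sub c

theorem snd_ne_zero (d : ℕ) : ContinuousLinearMap.snd ℝ (Space d) ℝ ≠ 0 := fun h => by
  simpa using congrArg (· (0, 1)) h

/-- Near a point of its side boundary, a covered region is the part of a half-space `0 ≤ h` over
`[0, 1]`. -/
theorem IsCoveredRegion.exists_function (hC : IsCoveredRegion D C N) (hd : d ≠ 0) (hp : p ∈ N) :
    ∃ h : SpaceTime d → ℝ, ContDiffAt ℝ 1 h p ∧
      (p.2 ∈ Ioo (0 : ℝ) 1 ∧ fderiv ℝ h p ≠ 0 ∨ ∃ v, fderiv ℝ h p (v, 0) ≠ 0) ∧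
      ∀ᶠ r in 𝓝 p, (r ∈ C ↔ 0 ≤ h r ∧ r.2 ∈ Icc (0 : ℝ) 1) ∧
        (r ∈ N ↔ h r = 0 ∧ r.2 ∈ Icc (0 : ℝ) 1) := by
  have hpC := hC.side_subset hp
  have hCt : ∀ r ∈ C, r.2 ∈ Icc (0 : ℝ) 1 := fun r hr => (hC.subset hr).2
  have hnear : ∀ {U : Set ℝ}, IsOpen U → p.2 ∈ U → ∀ᶠ r : SpaceTime d in 𝓝 p, r.2 ∈ U :=
    fun hU hpU => continuous_snd.continuousAt.eventually (hU.mem_nhds hpU)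
  by_cases h0 : p.2 = 0
  · obtain ⟨h, hh, ⟨⟨v, t⟩, hw, hw'⟩, hev⟩ := (hC.isCobordism.corner_left p
      ⟨⟨hpC, h0⟩, hp⟩).exists_function hd (hasStrictFDerivAt_snd_sub p 0) (snd_ne_zero d)
      (fun r hr => by simpa using (hCt r hr).1) (fun r => by simp [levelSet])
    -- A direction along which time has zero derivative is horizontal.
    obtain rfl : t = 0 := hw
    refine ⟨h, hh, .inr ⟨v, hw'⟩, ?_⟩
    filter_upwards [hev, hnear (isOpen_Iio (a := 1)) (by simp [h0])] with r hr hr1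
    have : r.2 ∈ Icc (0 : ℝ) 1 ↔ 0 ≤ r.2 - 0 :=
      ⟨fun h => by simpa using h.1, fun h => ⟨by simpa using h, le_of_lt hr1⟩⟩
    rwa [this]
  by_cases h1 : p.2 = 1
  · obtain ⟨h, hh, ⟨⟨v, t⟩, hw, hw'⟩, hev⟩ := (hC.isCobordism.corner_right p
      ⟨⟨hpC, h1⟩, hp⟩).exists_function hd (hasStrictFDerivAt_sub_snd p 1)
      (neg_ne_zero.2 (snd_ne_zero d))
      (fun r hr => by simpa using (hCt r hr).2)
      (fun r => by simp [levelSet, sub_eq_zero, eq_comm (a := (1 : ℝ))])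
    obtain rfl : t = 0 := by simpa using hw
    refine ⟨h, hh, .inr ⟨v, hw'⟩, ?_⟩
    filter_upwards [hev, hnear (isOpen_Ioi (a := 0)) (by simp [h1])] with r hr hr0
    have : r.2 ∈ Icc (0 : ℝ) 1 ↔ 0 ≤ 1 - r.2 :=
      ⟨fun h => by simpa using h.2, fun h => ⟨le_of_lt hr0, by simpa using h⟩⟩
    rwa [this]
  · have hpt : p.2 ∈ Ioo (0 : ℝ) 1 :=
      ⟨lt_of_le_of_ne (hCt p hpC).1 (Ne.symm h0), lt_of_le_of_ne (hCt p hpC).2 h1⟩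
    obtain ⟨h, hh, hne, hev⟩ := (hC.isCobordism.face_side p ⟨hp, by
      rintro (h | h)
      exacts [h0 h.2, h1 h.2]⟩).exists_function
    refine ⟨h, hh, .inl ⟨hpt, hne⟩, ?_⟩
    filter_upwards [hev, hnear isOpen_Ioo hpt] with r hr hrt
    simpa [Ioo_subset_Icc_self hrt] using hr

theorem exists_horizontal_of_fderiv_ne_zero {L : SpaceTime d →L[ℝ] ℝ} (hL : L ≠ 0)
    (h0 : L (0, 1) = 0) : ∃ v, L (v, 0) ≠ 0 := by
  by_contra! h
  apply hL
  refine ContinuousLinearMap.ext fun w => ?_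
  have : w = (w.1, 0) + w.2 • (0, 1) := by ext <;> simp
  rw [this, map_add, map_smul, h, h0]
  simp

theorem IsCoveredRegion.flatAt_side (hC : IsCoveredRegion D C N) (hd : d ≠ 0) (hp : p ∈ N) :
    FlatAt N p := by
  obtain ⟨h, hh, hcase, hev⟩ := hC.exists_function hd hp
  have hs := hh.hasStrictFDerivAt one_ne_zero
  rcases hcase with ⟨hpt, hne⟩ | ⟨v, hv⟩
  · refine flatAt_of_hasStrictFDerivAt hs hne (convex_singleton (0 : ℝ)) ?_
    filter_upwards [hev, continuous_snd.continuousAt.eventually (isOpen_Ioo.mem_nhds hpt)]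
      with r hr hrt
    simpa [Ioo_subset_Icc_self hrt] using hr.2
  · exact (timeFlatAt_of_hasStrictFDerivAt hs hv (convex_singleton (0 : ℝ)) (convex_Icc 0 1)
      (hev.mono fun r hr => hr.2)).flatAt

/-- Since `N` is locally path-connected, its component the wall is open in `N`. -/
theorem IsCoveredRegion.isClosed_essentialBoundary (hC : IsCoveredRegion D C N) (hd : d ≠ 0) :
    IsClosed (essentialBoundary D N) := by
  have := locallyPathConnectedSpace_of_flatAt fun q hq => hC.flatAt_side hd hq
  obtain ⟨p, hp, hw⟩ := hC.wall_isComponent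
  rw [connectedComponentIn_eq_image hp, ← pathComponent_eq_connectedComponent] at hw
  have hopen : IsClosed (pathComponent (⟨p, hp⟩ : N))ᶜ :=
    (IsOpen.pathComponent (⟨p, hp⟩ : N)).isClosed_compl
  have himage := hC.isCobordism.isClosed_side.isClosedMap_subtype_val _ hopen
  convert himage using 1
  rw [essentialBoundary, ← hw]
  ext q
  simp only [mem_sdiff, mem_image, Subtype.exists, mem_compl_iff]
  constructor
  · rintro ⟨hq, h⟩
    exact ⟨q, hq, fun h' => h ⟨q, hq, h', rfl⟩, rfl⟩
  · rintro ⟨q', hq', h, rfl⟩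
    refine ⟨hq', ?_⟩
    rintro ⟨q'', hq'', h', rfl⟩
    exact h h'

/-- The wall contains the vertical line through `p`, so `h` has zero vertical derivative and its
nonzero derivative is seen horizontally. -/
theorem IsCoveredRegion.exists_horizontal_of_mem_wall (hC : IsCoveredRegion D C N)
    {h : SpaceTime d → ℝ} (hp : p ∈ frontier D ×ˢ Icc (0 : ℝ) 1) (hh : ContDiffAt ℝ 1 h p)
    (hcase : p.2 ∈ Ioo (0 : ℝ) 1 ∧ fderiv ℝ h p ≠ 0 ∨ ∃ v, fderiv ℝ h p (v, 0) ≠ 0)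
    (hev : ∀ᶠ r in 𝓝 p, (r ∈ C ↔ 0 ≤ h r ∧ r.2 ∈ Icc (0 : ℝ) 1) ∧
        (r ∈ N ↔ h r = 0 ∧ r.2 ∈ Icc (0 : ℝ) 1)) : ∃ v, fderiv ℝ h p (v, 0) ≠ 0 := by
  rcases hcase with ⟨hpt, hne⟩ | h
  · refine exists_horizontal_of_fderiv_ne_zero hne ?_
    have h1 : HasDerivAt (fun t : ℝ => (p.1, t)) ((0, 1) : SpaceTime d) p.2 :=
      (hasDerivAt_const _ _).prodMk (hasDerivAt_id _)
    have h2 : HasFDerivAt h (fderiv ℝ h p) (p.1, p.2) :=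
      (hh.differentiableAt one_ne_zero).hasFDerivAt
    have h3 := h2.comp_hasDerivAt p.2 h1
    have h4 : HasDerivAt (h ∘ fun t : ℝ => (p.1, t)) 0 p.2 := by
      refine (hasDerivAt_const p.2 (0 : ℝ)).congr_of_eventuallyEq ?_
      have hc : Filter.Tendsto (fun t : ℝ => (p.1, t)) (𝓝 p.2) (𝓝 p) := by
        have : Continuous fun t : ℝ => (p.1, t) := by fun_prop
        exact this.tendsto p.2
      filter_upwards [hc.eventually hev, isOpen_Ioo.mem_nhds hpt] with t ht ht'
      exact (ht.2.1 (hC.wall_subset ⟨hp.1, Ioo_subset_Icc_self ht'⟩)).1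
    exact h3.unique h4
  · exact h

/-- Near the wall, the covered region fills `D × [0, 1]`. -/
theorem IsCoveredRegion.eventually_mem_of_mem_wall (hC : IsCoveredRegion D C N) (hd : d ≠ 0)
    (hD : IsClosed D) (hp : p ∈ frontier D ×ˢ Icc (0 : ℝ) 1) :
    ∀ᶠ r in 𝓝 p, r ∈ D ×ˢ Icc (0 : ℝ) 1 → r ∈ C := by
  obtain ⟨h, hh, hcase, hev⟩ := hC.exists_function hd (hC.wall_subset hp)
  obtain ⟨v, hv⟩ := hC.exists_horizontal_of_mem_wall hp hh hcase hev
  let P : Set (SpaceTime d) := {r | h r ∈ Iio 0 ∧ r.2 ∈ Icc (0 : ℝ) 1}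
  obtain ⟨F, hpF, -, K, hK, hPK⟩ := timeFlatAt_of_hasStrictFDerivAt (Z := P)
    (hh.hasStrictFDerivAt one_ne_zero) hv (convex_Iio 0) (convex_Icc 0 1)
    (Filter.Eventually.of_forall fun r => Iff.rfl)
  obtain ⟨U, V, hU, hpU, hUev, -, hV, hVt, hUP⟩ := exists_isOpen_inter_eq_image F hpF hK hPK hev
  -- The local side `h < 0` is connected and misses the wall, so its projection lies wholly inside
  -- or wholly outside `D`. Points outside `D` close to `p` are uncovered, which decides for
  -- outside.
  have hconn : IsPreconnected (Prod.fst '' (U ∩ P)) := by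
    rw [hUP]
    exact (hV.isPreconnected.image _ (F.continuousOn_symm.mono hVt)).image _
      continuous_fst.continuousOn
  have hmiss : ∀ r ∈ U ∩ P, r.1 ∉ frontier D := fun r hr hrD =>
    hr.2.1.ne ((hUev hr.1).2.1 (hC.wall_subset ⟨hrD, hr.2.2⟩)).1
  have hcover : Prod.fst '' (U ∩ P) ⊆ interior D ∪ Dᶜ := by
    rintro _ ⟨r, hr, rfl⟩
    by_cases hrD : r.1 ∈ D
    · refine .inl ?_
      by_contra hri
      exact hmiss r hr ⟨subset_closure hrD, hri⟩
    · exact .inr hrD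
  obtain ⟨z, hzD, hzU⟩ : ∃ z, z ∉ D ∧ (z, p.2) ∈ U ∩ P := by
    have hcl : p.1 ∈ closure Dᶜ := by
      rw [closure_compl]
      exact hp.1.2
    have hU' : IsOpen ((fun z : Space d => (z, p.2)) ⁻¹' U) := hU.preimage (by fun_prop)
    obtain ⟨z, hzU, hzD⟩ := mem_closure_iff.1 hcl _ hU' hpU
    refine ⟨z, hzD, hzU, ?_, hp.2⟩
    by_contra hneg
    exact hzD (hC.subset ((hUev hzU).1.2 ⟨not_lt.1 hneg, hp.2⟩)).1
  have hout : Prod.fst '' (U ∩ P) ⊆ Dᶜ := by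
    rcases hconn.subset_or_subset isOpen_interior hD.isOpen_compl
      (disjoint_compl_right.mono_left interior_subset) hcover with h | h
    · exact absurd (interior_subset (h ⟨_, hzU, rfl⟩)) hzD
    · exact h
  filter_upwards [hU.mem_nhds hpU] with r hr hrD
  refine (hUev hr).1.2 ⟨?_, hrD.2⟩
  by_contra hneg
  exact hout ⟨r, ⟨hr, not_le.1 hneg, hrD.2⟩, rfl⟩ hrD.1

/-- A covered point outside `B` is interior to `C`, on the wall, or on the bottom or top face; in
each case `C` fills `D × [0, 1]` nearby. -/
theorem IsCoveredRegion.isClosed_uncoveredRegion (hC : IsCoveredRegion D C N) (hd : d ≠ 0)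
    (hD : IsClosed D) : IsClosed (uncoveredRegion D C N) := by
  have hDI : IsClosed (D ×ˢ Icc (0 : ℝ) 1) := hD.prod isClosed_Icc
  have hB := hC.isClosed_essentialBoundary hd
  refine isClosed_of_closure_subset ?_
  rw [uncoveredRegion, closure_union, hB.closure_eq]
  refine union_subset (fun p hp => ?_) subset_union_right
  have hpD : p ∈ D ×ˢ Icc (0 : ℝ) 1 := closure_minimal sdiff_subset hDI hp
  by_cases hpC : p ∈ C
  swap
  · exact .inl ⟨hpD, hpC⟩
  refine .inr ?_
  by_contra hpB
  suffices h : ∀ᶠ r in 𝓝 p, r ∈ D ×ˢ Icc (0 : ℝ) 1 → r ∈ C by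
    obtain ⟨r, hr, hrD, hrC⟩ := mem_closure_iff_nhds.1 hp _ h
    exact hrC (hr hrD)
  by_cases hpi : p ∈ interior C
  · filter_upwards [isOpen_interior.mem_nhds hpi] with r hr _
    exact interior_subset hr
  have hpf : p ∈ frontier C := ⟨subset_closure hpC, hpi⟩
  rw [hC.isCobordism.boundary_eq] at hpf
  by_cases hpN : p ∈ N
  · refine hC.eventually_mem_of_mem_wall hd hD ?_
    by_contra hpw
    exact hpB ⟨hpN, hpw⟩
  · rcases hpf with (hp0 | hp') | hp1
    · refine ((hC.isCobordism.face_left p ⟨hp0, hpN⟩).eventually_mem (hasStrictFDerivAt_snd_sub p 0)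
        (snd_ne_zero d) (fun r hr => by simpa using (hC.subset hr).2.1)
        (fun r => by simp [levelSet])).mono fun r hr hrD => hr (by simpa using hrD.2.1)
    · exact absurd hp' hpN
    · refine ((hC.isCobordism.face_right p ⟨hp1, hpN⟩).eventually_mem
        (hasStrictFDerivAt_sub_snd p 1) (neg_ne_zero.2 (snd_ne_zero d))
        (fun r hr => by simpa using (hC.subset hr).2.2)
        (fun r => by simp [levelSet, sub_eq_zero, eq_comm (a := (1 : ℝ))])).mono
        fun r hr hrD => hr (by simpa using hrD.2.2)

theorem IsCoveredRegion.isCompact_essentialBoundary (hC : IsCoveredRegion D C N) (hd : d ≠ 0) :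
    IsCompact (essentialBoundary D N) :=
  hC.isCobordism.isCompact.of_isClosed_subset (hC.isClosed_essentialBoundary hd)
    (sdiff_subset.trans hC.side_subset)

theorem IsCoveredRegion.uncoveredRegion_subset (hC : IsCoveredRegion D C N) :
    uncoveredRegion D C N ⊆ D ×ˢ Icc (0 : ℝ) 1 :=
  union_subset sdiff_subset (sdiff_subset.trans (hC.side_subset.trans hC.subset))

theorem IsCoveredRegion.isCompact_uncoveredRegion (hC : IsCoveredRegion D C N) (hd : d ≠ 0)
    (hD : IsCompact D) : IsCompact (uncoveredRegion D C N) :=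
  (hD.prod isCompact_Icc).of_isClosed_subset (hC.isClosed_uncoveredRegion hd hD.isClosed)
    hC.uncoveredRegion_subset

theorem IsCoveredRegion.mem_interior_of_mem_uncoveredRegion (hC : IsCoveredRegion D C N)
    (hp : p ∈ uncoveredRegion D C N) : p.1 ∈ interior D := by
  by_contra hpi
  have hpD := hC.uncoveredRegion_subset hp
  have hpw : p ∈ frontier D ×ˢ Icc (0 : ℝ) 1 := ⟨⟨subset_closure hpD.1, hpi⟩, hpD.2⟩
  rcases hp with hp | hp
  · exact hp.2 (hC.side_subset (hC.wall_subset hpw))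
  · exact hp.2 hpw

/-- Near a point of the essential boundary, the uncovered region is the part of a half-space `h ≤ 0`
over `[0, 1]`. -/
theorem IsCoveredRegion.exists_function_of_mem_essentialBoundary (hC : IsCoveredRegion D C N)
    (hd : d ≠ 0) (hp : p ∈ essentialBoundary D N) :
    ∃ h : SpaceTime d → ℝ, ContDiffAt ℝ 1 h p ∧ h p = 0 ∧
      (p.2 ∈ Ioo (0 : ℝ) 1 ∧ fderiv ℝ h p ≠ 0 ∨ ∃ v, fderiv ℝ h p (v, 0) ≠ 0) ∧
      ∀ᶠ r in 𝓝 p, (r ∈ uncoveredRegion D C N ↔ h r ≤ 0 ∧ r.2 ∈ Icc (0 : ℝ) 1) ∧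
        (r ∈ essentialBoundary D N ↔ h r = 0 ∧ r.2 ∈ Icc (0 : ℝ) 1) := by
  obtain ⟨h, hh, hcase, hev⟩ := hC.exists_function hd hp.1
  refine ⟨h, hh, (hev.self_of_nhds.2.1 hp.1).1, hcase, ?_⟩
  have hint : ∀ᶠ r : SpaceTime d in 𝓝 p, r.1 ∈ interior D :=
    continuous_fst.continuousAt.eventually
      (isOpen_interior.mem_nhds (hC.mem_interior_of_mem_uncoveredRegion (C := C) (.inr hp)))
  filter_upwards [hev, hint, (isClosed_wall D).isOpen_compl.mem_nhds hp.2] with r hr hrD hrw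
  have hB : r ∈ essentialBoundary D N ↔ h r = 0 ∧ r.2 ∈ Icc (0 : ℝ) 1 := by
    rw [← hr.2]
    exact ⟨fun h => h.1, fun h => ⟨h, hrw⟩⟩
  refine ⟨?_, hB⟩
  rw [uncoveredRegion, mem_union, hB, mem_sdiff, hr.1, mem_prod]
  constructor
  · rintro (⟨⟨-, ht⟩, hneg⟩ | ⟨h0, ht⟩)
    · exact ⟨le_of_not_ge fun h => hneg ⟨h, ht⟩, ht⟩
    · exact ⟨h0.le, ht⟩
  · rintro ⟨hle, ht⟩
    rcases hle.eq_or_lt with h0 | hlt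
    · exact .inr ⟨h0, ht⟩
    · exact .inl ⟨⟨interior_subset hrD, ht⟩, fun h => hlt.not_ge h.1⟩

/-- A point where the horizontal derivative of a defining function vanishes is critical. -/
theorem isCriticalPoint_of_forall_horizontal {B : Set (SpaceTime d)} {h : SpaceTime d → ℝ}
    (hp : p ∈ B) (hh : ContDiffAt ℝ 1 h p) (hne : fderiv ℝ h p ≠ 0)
    (hB : ∀ᶠ r in 𝓝 p, r ∈ B → h r = 0) (hz : ∀ v, fderiv ℝ h p (v, 0) = 0) :
    IsCriticalPoint B p := by
  refine ⟨hp, fun w hw => ?_⟩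
  have h1 : HasFDerivWithinAt h (fderiv ℝ h p) B p :=
    (hh.differentiableAt one_ne_zero).hasFDerivAt.hasFDerivWithinAt
  have h2 : HasFDerivWithinAt h (0 : SpaceTime d →L[ℝ] ℝ) B p := by
    refine (hasFDerivWithinAt_const (0 : ℝ) p B).congr_of_eventuallyEq ?_ (hB.self_of_nhds hp)
    filter_upwards [mem_nhdsWithin_of_mem_nhds hB, self_mem_nhdsWithin] with r hr hrB
    exact hr hrB
  have h3 : fderiv ℝ h p w = 0 := h1.unique_on h2 hw
  by_contra hw2
  apply hne
  refine ContinuousLinearMap.ext fun z => ?_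
  -- A tangent vector with nonzero time component would span, with the horizontal vectors, the whole
  -- space, and the derivative of `h` would vanish.
  have e : z = (z.1 - (z.2 / w.2) • w.1, 0) + (z.2 / w.2) • w := by
    ext1
    · simp
    · simp [hw2]
  rw [e, map_add, map_smul, hz, h3]
  simp

end CoveredRegion

/-! ### Points in the same component of a set -/

section ConnIn

variable {T : Type*} [TopologicalSpace T] {A A' : Set T} {x y z : T}

/-- `x` and `y` lie in a common connected subset of `A`. -/
def ConnIn (A : Set T) (x y : T) : Prop :=
  ∃ K ⊆ A, IsPreconnected K ∧ x ∈ K ∧ y ∈ K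

theorem ConnIn.symm (h : ConnIn A x y) : ConnIn A y x := by
  obtain ⟨K, hKA, hK, hx, hy⟩ := h
  exact ⟨K, hKA, hK, hy, hx⟩

theorem ConnIn.trans (h : ConnIn A x y) (h' : ConnIn A y z) : ConnIn A x z := by
  obtain ⟨K, hKA, hK, hx, hy⟩ := h
  obtain ⟨K', hKA', hK', hy', hz'⟩ := h'
  exact ⟨K ∪ K', union_subset hKA hKA', hK.union y hy hy' hK', .inl hx, .inr hz'⟩

theorem ConnIn.mono (h : ConnIn A x y) (hA : A ⊆ A') : ConnIn A' x y := by
  obtain ⟨K, hKA, hK, hx, hy⟩ := h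
  exact ⟨K, hKA.trans hA, hK, hx, hy⟩

theorem connIn_of_continuousOn {γ : ℝ → T} {a b : ℝ} (hab : a ≤ b) (hγ : ContinuousOn γ (Icc a b))
    (hA : MapsTo γ (Icc a b) A) : ConnIn A (γ a) (γ b) :=
  ⟨γ '' Icc a b, hA.image_subset, isPreconnected_Icc.image _ hγ,
    ⟨a, left_mem_Icc.2 hab, rfl⟩, ⟨b, right_mem_Icc.2 hab, rfl⟩⟩

theorem connIn_of_joined {x y : A} (h : Joined x y) : ConnIn A (x : T) y := by
  obtain ⟨γ⟩ := h
  refine ⟨range fun t => (γ t : T), ?_, ?_, ⟨0, by simp⟩, ⟨1, by simp⟩⟩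
  · rintro _ ⟨t, rfl⟩
    exact (γ t).2
  · exact isPreconnected_range (by fun_prop)

theorem ConnIn.joined [LocallyPathConnectedSpace A] {x y : A} (h : ConnIn A (x : T) y) :
    Joined x y := by
  obtain ⟨K, hKA, hK, hx, hy⟩ := h
  have hpre : IsPreconnected (Subtype.val ⁻¹' K : Set A) := by
    rw [← Topology.IsInducing.subtypeVal.isPreconnected_image, Subtype.image_preimage_coe,
      inter_eq_right.2 hKA]
    exact hK
  have : y ∈ connectedComponent x := hpre.subset_connectedComponent hx hy
  rwa [← pathComponent_eq_connectedComponent] at this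

theorem isPreconnected_of_connIn (x₀ : T) (h : ∀ y ∈ A, ConnIn A x₀ y) : IsPreconnected A :=
  isPreconnected_of_forall x₀ fun y hy => by
    obtain ⟨K, hKA, hK, hx, hy⟩ := h y hy
    exact ⟨K, hKA, hx, hy, hK⟩

end ConnIn

/-- Leaving a closed set along a segment. -/
theorem exists_connIn_inter_of_segment {T : Type*} [NormedAddCommGroup T] [NormedSpace ℝ T]
    {X Y A : Set T} (hX : IsClosed X) (hY : IsClosed Y) (hA : Convex ℝ A) (hAXY : A ⊆ X ∪ Y)
    {x y : T} (hx : x ∈ X ∩ A) (hy : y ∈ Y ∩ A) : ∃ z ∈ X ∩ Y ∩ A, ConnIn (X ∩ A) x z := by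
  let γ : ℝ → T := fun s => AffineMap.lineMap x y s
  have hγ : Continuous γ := AffineMap.lineMap_continuous
  have hγA : MapsTo γ (Icc 0 1) A := fun s hs => hA.lineMap_mem hx.2 hy.2 hs
  -- Stop at the first parameter in `Y`; everything before lies in `X`, hence so does the stopping
  -- point unless it is the start, which is in `X` by assumption.
  have hc : IsCompact (Icc (0 : ℝ) 1 ∩ γ ⁻¹' Y) := isCompact_Icc.inter_right (hY.preimage hγ)
  obtain ⟨s, ⟨hs, hsY⟩, hleast⟩ := hc.exists_isLeast ⟨1, by simp, by simpa [γ] using hy.1⟩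
  have hlt : ∀ t ∈ Ico 0 s, γ t ∈ X := fun t ht => by
    have ht1 : t ∈ Icc (0 : ℝ) 1 := ⟨ht.1, ht.2.le.trans hs.2⟩
    rcases hAXY (hγA ht1) with h | h
    · exact h
    · exact absurd (hleast ⟨ht1, h⟩) ht.2.not_ge
  have hle : ∀ t ∈ Icc 0 s, γ t ∈ X := by
    rcases hs.1.eq_or_lt with h0 | hpos
    · intro t ht
      obtain rfl : t = 0 := le_antisymm (by rw [h0]; exact ht.2) ht.1
      simpa [γ] using hx.1
    · intro t ht
      have : t ∈ closure (Ico 0 s) := by rwa [closure_Ico hpos.ne]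
      exact closure_minimal hlt (hX.preimage hγ) this
  refine ⟨γ s, ⟨⟨hle s (right_mem_Icc.2 hs.1), hsY⟩, hγA hs⟩, ?_⟩
  have h0 : γ 0 = x := by simp [γ]
  rw [← h0]
  exact connIn_of_continuousOn hs.1 hγ.continuousOn fun t ht =>
    ⟨hle t ht, hγA ⟨ht.1, ht.2.trans hs.2⟩⟩

/-! ### Connectivity of uncovered regions -/

section Connectivity

variable {d : ℕ} {D : Set (Space d)} {C N : Set (SpaceTime d)}

theorem slab_eq_inter (M : Set (SpaceTime d)) (a b : ℝ) :
    slab M a b = M ∩ Prod.snd ⁻¹' Icc a b := rfl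

theorem levelSet_eq_slab (M : Set (SpaceTime d)) (t : ℝ) : levelSet M t = slab M t t := by
  ext p
  simp [levelSet, slab]

theorem slab_mono {M M' : Set (SpaceTime d)} (h : M ⊆ M') (a b : ℝ) : slab M a b ⊆ slab M' a b :=
  inter_subset_inter_left _ h

theorem IsCompact.slab {M : Set (SpaceTime d)} (hM : IsCompact M) (a b : ℝ) :
    IsCompact (slab M a b) :=
  hM.inter_right (isClosed_Icc.preimage continuous_snd)

/-- The projection of the compact slab to the interval is closed with nonempty connected fibres, so
a splitting into closed sets would already split one fibre or the interval. -/
theorem isPreconnected_slab {M : Set (SpaceTime d)} (hM : IsCompact M) {a b : ℝ}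
    (h : ∀ t ∈ Icc a b, IsConnected (levelSet M t)) : IsPreconnected (slab M a b) := by
  rw [isPreconnected_closed_iff]
  rintro U V hU hV hUV ⟨u, hu, huU⟩ ⟨v, hv, hvV⟩
  have hs := IsCompact.slab hM a b
  obtain ⟨t, ht, ⟨p, ⟨hp, hpU⟩, hpt⟩, ⟨q, ⟨hq, hqV⟩, hqt⟩⟩ := isPreconnected_closed_iff.1
    (isPreconnected_Icc (a := a) (b := b)) (Prod.snd '' (slab M a b ∩ U))
    (Prod.snd '' (slab M a b ∩ V)) ((hs.inter_right hU).image continuous_snd).isClosed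
    ((hs.inter_right hV).image continuous_snd).isClosed
    (fun t ht => by
      obtain ⟨p, hp, hpt⟩ := (h t ht).nonempty
      have hps : p ∈ slab M a b := levelSet_subset_slab M ht ⟨hp, hpt⟩
      rcases hUV hps with hpU | hpV
      · exact .inl ⟨p, ⟨hps, hpU⟩, hpt⟩
      · exact .inr ⟨p, ⟨hps, hpV⟩, hpt⟩)
    ⟨u.2, hu.2, u, ⟨hu, huU⟩, rfl⟩ ⟨v.2, hv.2, v, ⟨hv, hvV⟩, rfl⟩
  have hsub := levelSet_subset_slab M ht
  obtain ⟨z, hz, hzUV⟩ := isPreconnected_closed_iff.1 (h t ht).isPreconnected U V hU hV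
    (hsub.trans hUV) ⟨p, ⟨hp.1, hpt⟩, hpU⟩ ⟨q, ⟨hq.1, hqt⟩, hqV⟩
  exact ⟨z, hsub hz, hzUV⟩

/-- The complementary region of the uncovered region in `ℝᵈ × [0, 1]`. -/
def outerRegion (D : Set (Space d)) (C : Set (SpaceTime d)) : Set (SpaceTime d) :=
  C ∪ Dᶜ ×ˢ Icc (0 : ℝ) 1

theorem IsCoveredRegion.isClosed_outerRegion (hC : IsCoveredRegion D C N) :
    IsClosed (outerRegion D C) := by
  have : outerRegion D C = C ∪ closure Dᶜ ×ˢ Icc (0 : ℝ) 1 := by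
    refine Subset.antisymm (union_subset_union_right _ (prod_mono subset_closure subset_rfl)) ?_
    rintro p (hp | ⟨hp, ht⟩)
    · exact .inl hp
    · by_cases hpD : p.1 ∈ D
      · refine .inl (hC.side_subset (hC.wall_subset ⟨⟨subset_closure hpD, ?_⟩, ht⟩))
        rwa [closure_compl] at hp
      · exact .inr ⟨hpD, ht⟩
  rw [this]
  exact hC.isClosed.union (isClosed_closure.prod isClosed_Icc)

theorem IsCoveredRegion.uncoveredRegion_inter_outerRegion (hC : IsCoveredRegion D C N) :
    uncoveredRegion D C N ∩ outerRegion D C = essentialBoundary D N := by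
  ext p
  constructor
  · rintro ⟨⟨hpD, hpC⟩ | hp, hp' | hp'⟩
    · exact absurd hp' hpC
    · exact absurd hpD.1 hp'.1
    · exact hp
    · exact hp
  · exact fun hp => ⟨.inr hp, .inl (hC.side_subset hp.1)⟩

theorem IsCoveredRegion.uncoveredRegion_union_outerRegion (hC : IsCoveredRegion D C N) :
    uncoveredRegion D C N ∪ outerRegion D C = univ ×ˢ Icc (0 : ℝ) 1 := by
  ext p
  constructor
  · rintro (hp | hp | hp)
    · exact ⟨mem_univ _, (hC.uncoveredRegion_subset hp).2⟩
    · exact ⟨mem_univ _, (hC.subset hp).2⟩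
    · exact ⟨mem_univ _, hp.2⟩
  · rintro ⟨-, ht⟩
    by_cases hpC : p ∈ C
    · exact .inr (.inl hpC)
    · by_cases hpD : p.1 ∈ D
      · exact .inl (.inl ⟨⟨hpD, ht⟩, hpC⟩)
      · exact .inr (.inr ⟨hpD, ht⟩)

variable {a b : ℝ}

/-- The slab of `C` is connected. An exterior point is attached to it by a horizontal segment
towards a point of `D`, which first meets `D` on the wall and hence in `C`. -/
theorem IsCoveredRegion.isPreconnected_slab_outerRegion (hC : IsCoveredRegion D C N)
    (hD : IsClosed D) (hconn : ∀ t ∈ Icc (0 : ℝ) 1, IsConnected (levelSet C t)) (ha : 0 ≤ a)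
    (hab : a ≤ b) (hb : b ≤ 1) : IsPreconnected (slab (outerRegion D C) a b) := by
  have hsub : ∀ t ∈ Icc a b, t ∈ Icc (0 : ℝ) 1 := fun t ht => ⟨ha.trans ht.1, ht.2.trans hb⟩
  have hslab : IsPreconnected (slab C a b) :=
    isPreconnected_slab hC.isCobordism.isCompact fun t ht => hconn t (hsub t ht)
  have hslab' : slab C a b ⊆ slab (outerRegion D C) a b := slab_mono subset_union_left a b
  obtain ⟨x₀, hx₀, hx₀t⟩ := (hconn a (hsub a (left_mem_Icc.2 hab))).nonempty
  have hx₀s : x₀ ∈ slab C a b := levelSet_subset_slab C (left_mem_Icc.2 hab) ⟨hx₀, hx₀t⟩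
  refine isPreconnected_of_connIn x₀ fun y hy => ?_
  rcases hy with ⟨hyC | hyD, hyt⟩
  · exact ⟨slab C a b, hslab', hslab, hx₀s, ⟨hyC, hyt⟩⟩
  · have hyt' : y.2 ∈ Icc a b := hyt
    have hcl : IsClosed (Prod.fst ⁻¹' closure Dᶜ : Set (SpaceTime d)) :=
      isClosed_closure.preimage continuous_fst
    obtain ⟨z, ⟨⟨hz1, hz2⟩, hzt⟩, hyz⟩ := exists_connIn_inter_of_segment hcl
      (hD.preimage continuous_fst)
      ((convex_singleton y.2).linear_preimage (LinearMap.snd ℝ (Space d) ℝ)) (x := y)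
      (y := (x₀.1, y.2)) (fun p _ => by
        by_cases hp : p.1 ∈ D
        · exact .inr hp
        · exact .inl (subset_closure hp)) ⟨subset_closure hyD.1, rfl⟩ ⟨(hC.subset hx₀).1, rfl⟩
    have hwall : ∀ p : SpaceTime d, p.2 = y.2 → p.1 ∈ closure Dᶜ → p.1 ∈ D → p ∈ slab C a b := by
      intro p hpt hp1 hp2
      have hpt' : p.2 ∈ Icc a b := by rw [hpt]; exact hyt'
      refine ⟨hC.side_subset (hC.wall_subset ⟨⟨subset_closure hp2, ?_⟩, hsub _ hpt'⟩), hpt'⟩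
      rwa [closure_compl] at hp1
    refine ConnIn.trans (y := z)
      ⟨slab C a b, hslab', hslab, hx₀s, hwall z hzt hz1 hz2⟩ (hyz.symm.mono ?_)
    rintro p ⟨hp1, hpt⟩
    have hpt : p.2 = y.2 := hpt
    by_cases hpD : p.1 ∈ D
    · exact hslab' (hwall p hpt hp1 hpD)
    · exact ⟨.inr ⟨hpD, by rw [hpt]; exact hyD.2⟩, by rw [hpt]; exact hyt'⟩

theorem IsCoveredRegion.connIn_slab_essentialBoundary (hC : IsCoveredRegion D C N) (hd : d ≠ 0)
    (hD : IsClosed D) (hconn : ∀ t ∈ Icc (0 : ℝ) 1, IsConnected (levelSet C t)) (ha : 0 ≤ a)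
    (hab : a ≤ b) (hb : b ≤ 1) {x y : SpaceTime d} (hx : x ∈ essentialBoundary D N)
    (hy : y ∈ essentialBoundary D N) (h : ConnIn (slab (uncoveredRegion D C N) a b) x y) :
    ConnIn (slab (essentialBoundary D N) a b) x y := by
  obtain ⟨K, hK, hKc, hxK, hyK⟩ := h
  have hI : IsClosed (Prod.snd ⁻¹' Icc a b : Set (SpaceTime d)) :=
    isClosed_Icc.preimage continuous_snd
  have hinter : slab (uncoveredRegion D C N) a b ∩ slab (outerRegion D C) a b =
      slab (essentialBoundary D N) a b := by
    rw [slab_eq_inter, slab_eq_inter, ← inter_inter_distrib_right,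
      hC.uncoveredRegion_inter_outerRegion]
    rfl
  have hunion : slab (uncoveredRegion D C N) a b ∪ slab (outerRegion D C) a b =
      univ ×ˢ Icc a b := by
    rw [slab_eq_inter, slab_eq_inter, ← union_inter_distrib_right,
      hC.uncoveredRegion_union_outerRegion]
    ext p
    simp only [mem_inter_iff, mem_prod, mem_univ, true_and, mem_preimage, mem_Icc]
    exact ⟨fun h => h.2, fun h => ⟨⟨ha.trans h.1, h.2.trans hb⟩, h⟩⟩
  have hxo : x ∈ outerRegion D C := .inl (hC.side_subset hx.1)
  have hyo : y ∈ outerRegion D C := .inl (hC.side_subset hy.1)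
  have hmem := mem_connectedComponentIn_inter_of_convex
    ((hC.isClosed_uncoveredRegion hd hD).inter hI)
    (hC.isClosed_outerRegion.inter hI)
    (by
      change Convex ℝ (slab (uncoveredRegion D C N) a b ∪ slab (outerRegion D C) a b)
      rw [hunion]
      exact convex_univ.prod (convex_Icc a b))
    (hC.isPreconnected_slab_outerRegion hD hconn ha hab hb)
    (by
      change IsCompact (slab (uncoveredRegion D C N) a b ∩ slab (outerRegion D C) a b)
      rw [hinter]
      exact IsCompact.slab (hC.isCompact_essentialBoundary hd) a b)
    hKc hK hxK ⟨hxo, (hK hxK).2⟩ hyK ⟨hyo, (hK hyK).2⟩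
  change y ∈ connectedComponentIn
    (slab (uncoveredRegion D C N) a b ∩ slab (outerRegion D C) a b) x at hmem
  rw [hinter] at hmem
  exact ⟨_, connectedComponentIn_subset _ _, isPreconnected_connectedComponentIn,
    mem_connectedComponentIn ⟨hx, (hK hxK).2⟩, hmem⟩

theorem IsCoveredRegion.exists_connIn_levelSet (hC : IsCoveredRegion D C N) (hd : d ≠ 0)
    (hD : IsClosed D) {t : ℝ} (ht : t ∈ Icc (0 : ℝ) 1) (hne : (levelSet C t).Nonempty)
    {x : SpaceTime d} (hx : x ∈ levelSet (uncoveredRegion D C N) t) :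
    ∃ z ∈ levelSet (essentialBoundary D N) t, ConnIn (levelSet (uncoveredRegion D C N) t) x z := by
  obtain ⟨y, hy, hyt⟩ := hne
  obtain ⟨z, ⟨hz, hzt⟩, hxz⟩ := exists_connIn_inter_of_segment (hC.isClosed_uncoveredRegion hd hD)
    hC.isClosed_outerRegion
    ((convex_singleton t).linear_preimage (LinearMap.snd ℝ (Space d) ℝ))
    (fun p hp => by
      rw [hC.uncoveredRegion_union_outerRegion]
      have hp : p.2 = t := hp
      exact ⟨mem_univ _, by rw [hp]; exact ht⟩)
    (x := x) (y := y) hx ⟨.inl hy, hyt⟩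
  rw [hC.uncoveredRegion_inter_outerRegion] at hz
  exact ⟨z, ⟨hz, hzt⟩, hxz⟩

end Connectivity

/-! ### Local structure of the uncovered region -/

section LocalStructure

variable {d : ℕ} {D : Set (Space d)} {C N : Set (SpaceTime d)} {p : SpaceTime d} {a b : ℝ}

theorem IsCoveredRegion.timeFlatAt_of_notMem (hC : IsCoveredRegion D C N)
    (hp : p ∈ uncoveredRegion D C N) (hpB : p ∉ essentialBoundary D N) :
    TimeFlatAt (uncoveredRegion D C N) p := by
  have hpC : p ∉ C := by
    rcases hp with hp | hp
    · exact hp.2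
    · exact absurd hp hpB
  refine timeFlatAt_of_mem_iff (convex_Icc 0 1) ?_
  have hint : ∀ᶠ r : SpaceTime d in 𝓝 p, r.1 ∈ interior D :=
    continuous_fst.continuousAt.eventually
      (isOpen_interior.mem_nhds (hC.mem_interior_of_mem_uncoveredRegion hp))
  filter_upwards [hint, hC.isClosed.isOpen_compl.mem_nhds hpC] with r hrD hrC
  exact ⟨fun hr => (hC.uncoveredRegion_subset hr).2,
    fun hr => .inl ⟨⟨interior_subset hrD, hr⟩, hrC⟩⟩

/-- Noncritical points of the essential boundary have time-preserving flat charts; at critical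
points the uncovered region opens or closes. -/
theorem IsCoveredRegion.timeFlatAt_or (hC : IsCoveredRegion D C N) (hd : d ≠ 0)
    (hp : p ∈ essentialBoundary D N) :
    (TimeFlatAt (uncoveredRegion D C N) p ∧ TimeFlatAt (essentialBoundary D N) p) ∨
      (IsCriticalPoint (essentialBoundary D N) p ∧
        (OpensAt (uncoveredRegion D C N) p ∨ ClosesAt (uncoveredRegion D C N) p)) := by
  obtain ⟨h, hh, h0, hcase, hev⟩ := hC.exists_function_of_mem_essentialBoundary hd hp
  have hs := hh.hasStrictFDerivAt one_ne_zero
  by_cases hhor : ∃ v, fderiv ℝ h p (v, 0) ≠ 0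
  · obtain ⟨v, hv⟩ := hhor
    exact .inl ⟨timeFlatAt_of_hasStrictFDerivAt hs hv (convex_Iic 0) (convex_Icc 0 1)
        (hev.mono fun r hr => hr.1),
      timeFlatAt_of_hasStrictFDerivAt hs hv (convex_singleton 0) (convex_Icc 0 1)
        (hev.mono fun r hr => hr.2)⟩
  -- The derivative of `h` is purely vertical and nonzero. Its sign decides between opening and
  -- closing, whatever the index or degeneracy of the critical point.
  · obtain ⟨hpt, hne⟩ := hcase.resolve_right hhor
    push Not at hhor
    refine .inr ⟨isCriticalPoint_of_forall_horizontal hp hh hne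
      (hev.mono fun r hr hrB => (hr.2.1 hrB).1) hhor, ?_⟩
    have hcont : ∀ᶠ r in 𝓝 p, ContinuousAt h r :=
      (hh.eventually (by simp)).mono fun r hr => hr.continuousAt
    have hX : ∀ᶠ r in 𝓝 p, r ∈ uncoveredRegion D C N ↔ h r ≤ 0 := by
      filter_upwards [hev, continuous_snd.continuousAt.eventually (isOpen_Ioo.mem_nhds hpt)]
        with r hr hrt
      simpa [Ioo_subset_Icc_self hrt] using hr.1
    have hne0 : fderiv ℝ h p (0, 1) ≠ 0 := fun hz => by
      obtain ⟨v, hv⟩ := exists_horizontal_of_fderiv_ne_zero hne hz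
      exact hv (hhor v)
    rcases lt_or_gt_of_ne hne0 with hneg | hpos
    · exact .inl (opensAt_of_hasStrictFDerivAt hs hneg h0 hcont hX)
    · exact .inr (closesAt_of_hasStrictFDerivAt hs hpos h0 hcont hX)

theorem OpensAt.slab {Z : Set (SpaceTime d)} (h : OpensAt Z p) (hp : p.2 ∈ Ioo a b) :
    OpensAt (slab Z a b) p := by
  obtain ⟨ε, hε, h1, h2⟩ := h
  have ha : 0 < p.2 - a := sub_pos.2 hp.1
  have hb : 0 < b - p.2 := sub_pos.2 hp.2
  refine ⟨min ε (min (p.2 - a) (b - p.2)), lt_min hε (lt_min ha hb), ?_, ?_⟩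
  · intro x t t' hx ht ht' hle hxt
    simp only [lt_min_iff, abs_lt] at hx ht ht'
    refine ⟨h1 x t t' hx.1 (abs_lt.2 ht.1) (abs_lt.2 ht'.1) hle hxt.1, ?_, ?_⟩ <;> simp only <;>
      linarith [ht'.2.1.1, ht'.2.2.2]
  · intro s hs hs'
    rw [← sub_lt_iff_lt_add', lt_min_iff, lt_min_iff] at hs'
    refine Filter.inter_mem (h2 s hs (by linarith [hs'.1])) ?_
    exact continuous_snd.continuousAt.preimage_mem_nhds
      (Icc_mem_nhds (by simp only; linarith) (by simp only; linarith [hs'.2.2]))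

theorem ClosesAt.slab {Z : Set (SpaceTime d)} (h : ClosesAt Z p) (hp : p.2 ∈ Ioo a b) :
    ClosesAt (slab Z a b) p := by
  obtain ⟨ε, hε, h1, h2⟩ := h
  have ha : 0 < p.2 - a := sub_pos.2 hp.1
  have hb : 0 < b - p.2 := sub_pos.2 hp.2
  refine ⟨min ε (min (p.2 - a) (b - p.2)), lt_min hε (lt_min ha hb), ?_, ?_⟩
  · intro x t t' hx ht ht' hle hxt
    simp only [lt_min_iff, abs_lt] at hx ht ht'
    refine ⟨h1 x t t' hx.1 (abs_lt.2 ht.1) (abs_lt.2 ht'.1) hle hxt.1, ?_, ?_⟩ <;> simp only <;>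
      linarith [ht'.2.1.1, ht'.2.2.2]
  · intro s hs' hs
    rw [sub_lt_comm, lt_min_iff, lt_min_iff] at hs'
    refine Filter.inter_mem (h2 s (by linarith [hs'.1]) hs) ?_
    exact continuous_snd.continuousAt.preimage_mem_nhds
      (Icc_mem_nhds (by simp only; linarith [hs'.2.1]) (by simp only; linarith))

/-- Slabs of the essential boundary between regular values are locally path-connected. -/
theorem IsCoveredRegion.flatAt_slab (hC : IsCoveredRegion D C N) (hd : d ≠ 0)
    (ha : a ∉ criticalValues (essentialBoundary D N))
    (hb : b ∉ criticalValues (essentialBoundary D N))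
    (hp : p ∈ slab (essentialBoundary D N) a b) : FlatAt (slab (essentialBoundary D N) a b) p := by
  rcases hC.timeFlatAt_or hd hp.1 with h | ⟨hcrit, -⟩
  · exact (h.2.inter (convex_Icc a b)).flatAt
  -- As the end points are regular values, a critical point lies strictly inside the slab, which
  -- therefore agrees with `N` near it.
  · have hpt : p.2 ∈ Ioo a b :=
      ⟨lt_of_le_of_ne hp.2.1 fun h => ha ⟨p, hcrit, h.symm⟩,
        lt_of_le_of_ne hp.2.2 fun h => hb ⟨p, hcrit, h⟩⟩
    obtain ⟨F, hpF, K, hK, hev⟩ := hC.flatAt_side hd hp.1.1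
    refine ⟨F, hpF, K, hK, ?_⟩
    filter_upwards [hev, (isClosed_wall D).isOpen_compl.mem_nhds hp.1.2,
      continuous_snd.continuousAt.eventually (isOpen_Ioo.mem_nhds hpt)] with r hr hrw hrt
    rw [← hr]
    exact ⟨fun h => h.1.1, fun h => ⟨⟨h, hrw⟩, Ioo_subset_Icc_self hrt⟩⟩

theorem IsCoveredRegion.locallyPathConnectedSpace_slab (hC : IsCoveredRegion D C N) (hd : d ≠ 0)
    (ha : a ∉ criticalValues (essentialBoundary D N))
    (hb : b ∉ criticalValues (essentialBoundary D N)) :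
    LocallyPathConnectedSpace (slab (essentialBoundary D N) a b) :=
  locallyPathConnectedSpace_of_flatAt fun _ hq => hC.flatAt_slab hd ha hb hq

theorem isCriticalPoint_side (hp : IsCriticalPoint (essentialBoundary D N) p) :
    IsCriticalPoint N p := by
  refine ⟨hp.1.1, fun v hv => hp.2 v ?_⟩
  rw [← tangentConeAt_inter_nhds ((isClosed_wall D).isOpen_compl.mem_nhds hp.1.2)] at hv
  exact hv

/-- Over an interval with regular end points that contains at most one critical value, points of the
uncovered region in the same component are joined by a section. -/
theorem IsCoveredRegion.reach_of_connIn (hC : IsCoveredRegion D C N) (hd : d ≠ 0)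
    (hD : IsCompact D)
    (ha : a ∉ criticalValues (essentialBoundary D N))
    (hb : b ∉ criticalValues (essentialBoundary D N)) (hab : a < b)
    (hsub : (criticalValues (essentialBoundary D N) ∩ Icc a b).Subsingleton) {x y : SpaceTime d}
    (hx : x.2 = a) (hy : y.2 = b) (h : ConnIn (slab (uncoveredRegion D C N) a b) x y) :
    Reach (slab (uncoveredRegion D C N) a b) x y := by
  -- Only critical points of `B` can be singular. One critical value and distinct values at distinct
  -- critical points leave at most one of them.
  have hkey : ∀ z ∈ slab (uncoveredRegion D C N) a b,
      ¬ RegularAt (slab (uncoveredRegion D C N) a b) z →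
      IsCriticalPoint (essentialBoundary D N) z ∧
        (OpensAt (uncoveredRegion D C N) z ∨ ClosesAt (uncoveredRegion D C N) z) := by
    intro z hz hzreg
    by_cases hzB : z ∈ essentialBoundary D N
    · rcases hC.timeFlatAt_or hd hzB with h | h
      · exact absurd (h.1.inter (convex_Icc a b)).regularAt hzreg
      · exact h
    · exact absurd ((hC.timeFlatAt_of_notMem hz.1 hzB).inter (convex_Icc a b)).regularAt hzreg
  obtain ⟨K, hKX, hK, hxK, hyK⟩ := h
  refine reach_of_isPreconnected_of_subsingleton
    (IsCompact.slab (hC.isCompact_uncoveredRegion hd hD) a b) ?_ (by rw [hx, hy]; exact hab) ?_ ?_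
    hK hKX hxK hyK
  · intro z hz
    rw [hx, hy]
    exact hz.2
  · rintro z ⟨hz, hzreg⟩ w ⟨hw, hwreg⟩
    have hzc := (hkey z hz hzreg).1
    have hwc := (hkey w hw hwreg).1
    exact hC.critical_injOn (isCriticalPoint_side hzc) (isCriticalPoint_side hwc)
      (hsub ⟨⟨z, hzc, rfl⟩, hz.2⟩ ⟨⟨w, hwc, rfl⟩, hw.2⟩)
  · intro z hz hzreg
    obtain ⟨hzc, hmod⟩ := hkey z hz hzreg
    have hzt : z.2 ∈ Ioo a b :=
      ⟨lt_of_le_of_ne hz.2.1 fun h => ha ⟨z, hzc, h.symm⟩,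
        lt_of_le_of_ne hz.2.2 fun h => hb ⟨z, hzc, h⟩⟩
    exact ⟨by rw [hx, hy]; exact hzt, hmod.imp (fun h => h.slab hzt) fun h => h.slab hzt⟩

end LocalStructure

/-! ### Characters of `H⁰` -/

section Characters

variable {k A : Type*} [Field k] [TopologicalSpace A]

/-- The `0`-simplex at a point. -/
def pointSimplex (x : A) : SingularSimplex 0 A := ContinuousMap.const _ x

theorem eq_pointSimplex (σ : SingularSimplex 0 A) (v : stdSimplex ℝ (Fin (0 + 1))) :
    σ = pointSimplex (σ v) := by
  ext w
  have : Subsingleton (stdSimplex ℝ (Fin (0 + 1))) :=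
    inferInstanceAs (Subsingleton (stdSimplex ℝ (Fin 1)))
  rw [Subsingleton.elim w v]
  rfl

/-- Degree-zero cocycles are the functions constant on path components, as `1`-simplices are paths.
-/
theorem mem_H0_iff {φ : SingularCochain 0 k A} :
    φ ∈ H0 k A ↔ ∀ x y, Joined x y → φ (pointSimplex x) = φ (pointSimplex y) := by
  have hface : ∀ σ : SingularSimplex 1 A, φ (σ.face 0) - φ (σ.face 1) = coboundary φ σ :=
    fun σ => (coboundary_zero_apply φ σ).symm
  let v₀ : stdSimplex ℝ (Fin (0 + 1)) := stdSimplex.vertex 0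
  constructor
  · rintro h x y ⟨γ⟩
    -- The barycentric coordinate of vertex `0` vanishes on the face opposite to it, so face `0` is
    -- the start `x` of the path and face `1` its end.
    have hc : Continuous fun v : stdSimplex ℝ (Fin (1 + 1)) => γ.extend (v.1 0) := by
      have : Continuous fun v : stdSimplex ℝ (Fin (1 + 1)) => v.1 0 :=
        (continuous_apply 0).comp continuous_subtype_val
      exact γ.continuous_extend.comp this
    let σ : SingularSimplex 1 A := ⟨_, hc⟩
    have h0 : σ.face 0 = pointSimplex x := by
      rw [eq_pointSimplex (σ.face 0) v₀]
      congr 1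
      simp [σ, SingularSimplex.face, v₀]
    have h1 : σ.face 1 = pointSimplex y := by
      rw [eq_pointSimplex (σ.face 1) v₀]
      congr 1
      simp [σ, SingularSimplex.face, v₀]
    have h2 := hface σ
    rw [show coboundary φ = 0 from h, h0, h1, Pi.zero_apply, sub_eq_zero] at h2
    exact h2
  · intro h
    funext σ
    rw [← hface, Pi.zero_apply, sub_eq_zero, eq_pointSimplex (σ.face 0) v₀,
      eq_pointSimplex (σ.face 1) v₀]
    refine h _ _ ?_
    have : PathConnectedSpace (stdSimplex ℝ (Fin (1 + 1))) :=
      isPathConnected_iff_pathConnectedSpace.1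
        ((convex_stdSimplex ℝ (Fin (1 + 1))).isPathConnected
          ⟨_, (stdSimplex.vertex (S := ℝ) (0 : Fin (1 + 1))).2⟩)
    obtain ⟨γ⟩ := PathConnectedSpace.joined (stdSimplex.map (Fin.succAbove (0 : Fin (1 + 1))) v₀)
      (stdSimplex.map (Fin.succAbove (1 : Fin (1 + 1))) v₀)
    exact ⟨γ.map σ.continuous⟩

/-- Evaluation at a point, as a character of `H⁰`. -/
def evalAt (k : Type*) [Field k] (x : A) : H0Dual k A :=
  (Pi.evalAlgHom k (fun _ : SingularSimplex 0 A => k) (pointSimplex x)).comp (H0 k A).val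

@[simp] theorem evalAt_apply (x : A) (φ : H0 k A) : evalAt k x φ = φ.1 (pointSimplex x) := rfl

theorem evalAt_eq_of_joined {x y : A} (h : Joined x y) : evalAt k x = evalAt k y :=
  AlgHom.ext fun φ => mem_H0_iff.1 φ.2 x y h

open Classical in
/-- The indicator function of a path component. -/
noncomputable def componentIndicator (k : Type*) [Field k] (x : A) : H0 k A :=
  ⟨fun σ => if Joined x (σ (stdSimplex.vertex 0)) then 1 else 0, by
    rw [mem_H0_iff]
    intro y z hyz
    by_cases h : Joined x y
    · simp [pointSimplex, h, h.trans hyz]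
    · have h' : ¬ Joined x z := fun h' => h (h'.trans hyz.symm)
      simp [pointSimplex, h, h']⟩

theorem componentIndicator_of_joined {x y : A} (h : Joined x y) :
    (componentIndicator k x).1 (pointSimplex y) = 1 := by
  simp [componentIndicator, pointSimplex, h]

theorem componentIndicator_of_not_joined {x y : A} (h : ¬ Joined x y) :
    (componentIndicator k x).1 (pointSimplex y) = 0 := by
  simp [componentIndicator, pointSimplex, h]

theorem joined_of_evalAt_eq {x y : A} (h : evalAt k x = evalAt k y) : Joined x y := by
  by_contra hn
  have := DFunLike.congr_fun h (componentIndicator k x)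
  rw [evalAt_apply, evalAt_apply, componentIndicator_of_joined (Joined.refl x),
    componentIndicator_of_not_joined hn] at this
  exact one_ne_zero this

theorem mul_componentIndicator (φ : H0 k A) (x : A) :
    φ * componentIndicator k x = φ.1 (pointSimplex x) • componentIndicator k x := by
  apply Subtype.ext
  funext σ
  rw [eq_pointSimplex σ (stdSimplex.vertex 0)]
  set y := σ (stdSimplex.vertex 0)
  change φ.1 (pointSimplex y) * (componentIndicator k x).1 (pointSimplex y) =
    φ.1 (pointSimplex x) * (componentIndicator k x).1 (pointSimplex y)
  by_cases h : Joined x y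
  · rw [mem_H0_iff.1 φ.2 x y h]
  · rw [componentIndicator_of_not_joined h, mul_zero, mul_zero]

/-- On a compact locally path-connected space, all characters of `H⁰` are evaluations. -/
theorem exists_eq_evalAt [CompactSpace A] [LocallyPathConnectedSpace A] (χ : H0Dual k A) :
    ∃ x, χ = evalAt k x := by
  obtain ⟨t, ht⟩ := isCompact_univ.elim_finite_subcover (fun x : A => pathComponent x)
    (fun x => IsOpen.pathComponent x) fun x _ => mem_iUnion.2 ⟨x, mem_pathComponent_self x⟩
  -- Finitely many path components cover `A`, so this product vanishes pointwise. As `k` is a field,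
  -- `χ` sends some indicator to `1`, and multiplying by that indicator turns `χ` into evaluation.
  have hprod : ∏ x ∈ t, (1 - componentIndicator k x) = 0 := by
    apply Subtype.ext
    funext σ
    rw [eq_pointSimplex σ (stdSimplex.vertex 0)]
    set y := σ (stdSimplex.vertex 0)
    obtain ⟨x, hx, hxy⟩ := mem_iUnion₂.1 (ht (mem_univ y))
    change evalAt k y (∏ x ∈ t, (1 - componentIndicator k x)) = 0
    rw [map_prod]
    refine Finset.prod_eq_zero hx ?_
    rw [map_sub, map_one, evalAt_apply, componentIndicator_of_joined hxy, sub_self]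
  have h0 := congrArg χ hprod
  rw [map_prod, map_zero, Finset.prod_eq_zero_iff] at h0
  obtain ⟨x, -, hx⟩ := h0
  rw [map_sub, map_one, sub_eq_zero] at hx
  refine ⟨x, AlgHom.ext fun φ => ?_⟩
  have h1 := congrArg χ (mul_componentIndicator φ x)
  rw [map_mul, map_smul, ← hx, mul_one, smul_eq_mul, mul_one] at h1
  exact h1

end Characters

/-! ### The map from evasion paths to the inverse limit -/

section Main

variable {d n : ℕ} {D : Set (Space d)} {C N : Set (SpaceTime d)}

theorem Interleaving.mem_Icc {B : Set (SpaceTime d)} (S : Interleaving B n) (i : Fin (n + 1)) :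
    S.s i ∈ Icc (0 : ℝ) 1 := by
  rw [← S.zero, ← S.last]
  exact ⟨S.strictMono.monotone (Fin.zero_le i), S.strictMono.monotone (Fin.le_last i)⟩

theorem Interleaving.lt {B : Set (SpaceTime d)} (S : Interleaving B n) (i : Fin n) :
    S.s i.castSucc < S.s i.succ :=
  S.strictMono i.castSucc_lt_succ

/-- The position of an evasion path at time `t`. -/
def EvasionPath.pos (δ : EvasionPath D C N) {t : ℝ} (ht : t ∈ Icc (0 : ℝ) 1) : SpaceTime d :=
  (δ.1 ⟨t, ht⟩ : SpaceTime d)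

theorem EvasionPath.pos_mem (δ : EvasionPath D C N) {t : ℝ} (ht : t ∈ Icc (0 : ℝ) 1) :
    δ.pos ht ∈ levelSet (uncoveredRegion D C N) t :=
  ⟨(δ.1 ⟨t, ht⟩).2, δ.2 ⟨t, ht⟩⟩

theorem EvasionPath.connIn_slab (δ : EvasionPath D C N) {a b : ℝ} (ha : a ∈ Icc (0 : ℝ) 1)
    (hb : b ∈ Icc (0 : ℝ) 1) (hab : a ≤ b) :
    ConnIn (slab (uncoveredRegion D C N) a b) (δ.pos ha) (δ.pos hb) := by
  have hI : ∀ t ∈ Icc a b, t ∈ Icc (0 : ℝ) 1 := fun t ht => ⟨ha.1.trans ht.1, ht.2.trans hb.2⟩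
  let γ : ℝ → SpaceTime d := fun t => (δ.1 (projIcc 0 1 zero_le_one t) : SpaceTime d)
  have hγ : Continuous γ := by
    have : Continuous (projIcc (0 : ℝ) 1 zero_le_one) := continuous_projIcc
    exact continuous_subtype_val.comp (δ.1.continuous.comp this)
  have hγpos : ∀ t (ht : t ∈ Icc (0 : ℝ) 1), γ t = δ.pos ht := fun t ht => by
    simp only [γ, EvasionPath.pos, projIcc_of_mem zero_le_one ht]
  rw [← hγpos a ha, ← hγpos b hb]
  refine connIn_of_continuousOn hab hγ.continuousOn fun t ht => ?_
  rw [hγpos t (hI t ht)]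
  have h := δ.pos_mem (hI t ht)
  exact ⟨h.1, by rw [h.2]; exact ht⟩

theorem EvasionPath.connIn_levelSet_of_joined {δ δ' : EvasionPath D C N} (h : Joined δ δ') {t : ℝ}
    (ht : t ∈ Icc (0 : ℝ) 1) :
    ConnIn (levelSet (uncoveredRegion D C N) t) (δ.pos ht) (δ'.pos ht) := by
  obtain ⟨γ⟩ := h
  have hc : Continuous fun s => (γ s).pos ht := by
    have h1 : Continuous fun s => (γ s).1 := continuous_subtype_val.comp γ.continuous
    exact continuous_subtype_val.comp ((continuous_eval_const (⟨t, ht⟩ : unitInterval)).comp h1)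
  refine ⟨range fun s => (γ s).pos ht, ?_, isPreconnected_range hc, ⟨0, by simp⟩, ⟨1, by simp⟩⟩
  rintro _ ⟨s, rfl⟩
  exact (γ s).pos_mem ht

/-- Sections over the intervals between consecutive times glue to an evasion path. -/
theorem exists_evasionPath {B : Set (SpaceTime d)} (S : Interleaving B n)
    (x : Fin (n + 1) → SpaceTime d) (hx : ∀ i, (x i).2 = S.s i)
    (hreach : ∀ i : Fin n, Reach (uncoveredRegion D C N) (x i.castSucc) (x i.succ))
    (hx₀ : x 0 ∈ uncoveredRegion D C N) :
    ∃ δ : EvasionPath D C N, ∀ i, δ.pos (S.mem_Icc i) = x i := by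
  -- Deleting all points at time `sᵢ` other than `xᵢ` forces any section of `Z` through the
  -- prescribed points, so gluing needs no bookkeeping.
  let Z : Set (SpaceTime d) := {p ∈ uncoveredRegion D C N | ∀ i, p.2 = S.s i → p = x i}
  have hZ₀ : x 0 ∈ Z := ⟨hx₀, fun i hi => by
    rw [hx 0] at hi
    rw [S.strictMono.injective hi]⟩
  have hstep : ∀ i : Fin n, Reach Z (x i.castSucc) (x i.succ) := by
    intro i
    obtain ⟨hle, σ, hc, hσ, h0, h1⟩ := hreach i
    refine ⟨hle, σ, hc, fun t ht => ⟨hσ t ht, fun j hj => ?_⟩, h0, h1⟩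
    have hj : t = S.s j := hj
    subst hj
    rw [hx, hx] at ht
    have h2 := S.strictMono.le_iff_le.1 ht.1
    have h3 := S.strictMono.le_iff_le.1 ht.2
    rcases h2.eq_or_lt with rfl | h2
    · exact Prod.ext (by rw [← h0, hx]) (hx _).symm
    · obtain rfl : j = i.succ := le_antisymm h3 (Fin.castSucc_lt_iff_succ_le.1 h2)
      exact Prod.ext (by rw [← h1, hx]) (hx _).symm
  have hall : ∀ i, Reach Z (x 0) (x i) := by
    intro i
    induction i using Fin.induction with
    | zero => exact Reach.refl hZ₀
    | succ i ih => exact ih.trans (hstep i)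
  obtain ⟨-, σ, hc, hσ, -, -⟩ := hall (Fin.last n)
  rw [hx, hx, S.zero, S.last] at hc hσ
  have hcont : Continuous fun t : unitInterval => ((σ t, (t : ℝ)) : SpaceTime d) :=
    (continuousOn_iff_continuous_domRestrict.1 hc).prodMk continuous_subtype_val
  refine ⟨⟨⟨fun t => ⟨(σ t, t), (hσ t t.2).1⟩, hcont.subtype_mk _⟩, fun t => rfl⟩, fun i => ?_⟩
  exact (hσ _ (S.mem_Icc i)).2 i rfl

variable {k : Type u} [Field k]

theorem exists_surjective_zigzagLimit (hd : d ≠ 0) (hD : IsCompact D)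
    (hC : IsCoveredRegion D C N) (hconn : ∀ t ∈ Icc (0 : ℝ) 1, IsConnected (levelSet C t))
    (S : Interleaving (essentialBoundary D N) n) :
    ∃ F : ZerothHomotopy (EvasionPath D C N) → ZigzagLimit k S (essentialBoundary D N),
      Function.Surjective F := by
  -- The connectivity statement over the degenerate interval `[sᵢ, sᵢ]`; it makes the component
  -- chosen by an evasion path unique.
  have hlevel : ∀ i, ∀ x y : levelSet (essentialBoundary D N) (S.s i),
      ConnIn (levelSet (uncoveredRegion D C N) (S.s i)) (x : SpaceTime d) y →
      evalAt k x = evalAt k y := by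
    intro i x y h
    have hI := S.mem_Icc i
    have hlpc : LocallyPathConnectedSpace (levelSet (essentialBoundary D N) (S.s i)) := by
      rw [levelSet_eq_slab]
      exact hC.locallyPathConnectedSpace_slab hd (S.regular i) (S.regular i)
    refine evalAt_eq_of_joined (ConnIn.joined ?_)
    rw [levelSet_eq_slab] at h
    exact (hC.connIn_slab_essentialBoundary hd hD.isClosed hconn hI.1 le_rfl hI.2 x.2.1 y.2.1
      h).mono (levelSet_eq_slab _ _).ge
  have hex : ∀ (δ : EvasionPath D C N) (i : Fin (n + 1)),
      ∃ z : levelSet (essentialBoundary D N) (S.s i),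
        ConnIn (levelSet (uncoveredRegion D C N) (S.s i)) (δ.pos (S.mem_Icc i)) z := by
    intro δ i
    obtain ⟨z, hz, h⟩ := hC.exists_connIn_levelSet hd hD.isClosed (S.mem_Icc i)
      (hconn _ (S.mem_Icc i)).nonempty (δ.pos_mem (S.mem_Icc i))
    exact ⟨⟨z, hz⟩, h⟩
  choose z hz using hex
  have hcompat : ∀ (δ : EvasionPath D C N) (i : Fin n),
      evalAt k (S.inclRight (essentialBoundary D N) i (z δ i.succ)) =
        evalAt k (S.inclLeft (essentialBoundary D N) i (z δ i.castSucc)) := by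
    intro δ i
    have := hC.locallyPathConnectedSpace_slab hd (S.regular i.castSucc) (S.regular i.succ)
    refine evalAt_eq_of_joined (ConnIn.joined ?_)
    have hl := levelSet_subset_slab (uncoveredRegion D C N) (left_mem_Icc.2 (S.lt i).le)
    have hr := levelSet_subset_slab (uncoveredRegion D C N) (right_mem_Icc.2 (S.lt i).le)
    refine hC.connIn_slab_essentialBoundary hd hD.isClosed hconn (S.mem_Icc _).1 (S.lt i).le
      (S.mem_Icc _).2 (z δ i.succ).2.1 (z δ i.castSucc).2.1 ?_
    exact ((hz δ i.succ).symm.mono hr).trans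
      ((δ.connIn_slab (S.mem_Icc _) (S.mem_Icc _) (S.lt i).le).symm.trans
        ((hz δ i.castSucc).mono hl))
  let G : EvasionPath D C N → ZigzagLimit k S (essentialBoundary D N) := fun δ =>
    ⟨(fun i => evalAt k (z δ i),
      fun i => evalAt k (S.inclLeft (essentialBoundary D N) i (z δ i.castSucc))),
      fun i => ⟨rfl, hcompat δ i⟩⟩
  -- Compatibility determines the slab characters from the level characters.
  have hext : ∀ (δ : EvasionPath D C N) (χ : ZigzagLimit k S (essentialBoundary D N)),
      (∀ i, evalAt k (z δ i) = χ.1.1 i) → G δ = χ := by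
    intro δ χ h
    apply Subtype.ext
    refine Prod.ext (funext h) (funext fun i => ?_)
    rw [← (χ.2 i).1, ← h]
    rfl
  refine ⟨Quotient.lift G fun δ δ' h => hext δ _ fun i => hlevel i _ _ ?_, fun χ => ?_⟩
  · exact (hz δ i).symm.trans
      ((EvasionPath.connIn_levelSet_of_joined h (S.mem_Icc i)).trans (hz δ' i))
  · have hb : ∀ i, ∃ x : levelSet (essentialBoundary D N) (S.s i), χ.1.1 i = evalAt k x := by
      intro i
      have hlpc : LocallyPathConnectedSpace (levelSet (essentialBoundary D N) (S.s i)) := by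
        rw [levelSet_eq_slab]
        exact hC.locallyPathConnectedSpace_slab hd (S.regular i) (S.regular i)
      have hcpt : CompactSpace (levelSet (essentialBoundary D N) (S.s i)) := by
        rw [← isCompact_iff_compactSpace, levelSet_eq_slab]
        exact IsCompact.slab (hC.isCompact_essentialBoundary hd) _ _
      exact exists_eq_evalAt _
    choose x hx using hb
    obtain ⟨δ, hδ⟩ := exists_evasionPath (D := D) (C := C) (N := N) S (fun i => (x i : SpaceTime d))
      (fun i => (x i).2.2) (fun i => by
        have h1 := (χ.2 i).1.trans (χ.2 i).2.symm
        rw [hx, hx] at h1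
        have h2 : ConnIn (slab (essentialBoundary D N) (S.s i.castSucc) (S.s i.succ))
            (x i.castSucc : SpaceTime d) (x i.succ) :=
          connIn_of_joined (joined_of_evalAt_eq (k := k)
            (x := S.inclLeft (essentialBoundary D N) i (x i.castSucc))
            (y := S.inclRight (essentialBoundary D N) i (x i.succ)) h1)
        -- Equal characters of the slab of `B` put consecutive points in one component of the slab
        -- of `X`, where a section joins them.
        exact (hC.reach_of_connIn hd hD (S.regular _) (S.regular _) (S.lt i) (S.subsingleton i)
          (x i.castSucc).2.2 (x i.succ).2.2 (h2.mono (slab_mono subset_union_right _ _))).mono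
          fun w hw _ => hw.1) (.inr (x 0).2.1)
    refine ⟨Quotient.mk _ δ, hext δ χ fun i => ?_⟩
    rw [hx]
    refine (hlevel i _ _ ?_).symm
    rw [← hδ i]
    exact hz δ i

end Main

end Evasion

theorem mainTheorem3 {k : Type u} [Field k] {d : ℕ} (hd : 2 ≤ d)
    (D : Set (Evasion.Space d)) (hD : Evasion.IsSmoothBall D)
    (C N : Set (Evasion.SpaceTime d)) (hC : Evasion.IsCoveredRegion D C N)
    (hconn : ∀ t ∈ Set.Icc (0 : ℝ) 1, IsConnected (Evasion.levelSet C t))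
    {n : ℕ} (S : Evasion.Interleaving (Evasion.essentialBoundary D N) n) :
    (∃ F : ZerothHomotopy (Evasion.EvasionPath D C N) →
        Evasion.ZigzagLimit k S (Evasion.essentialBoundary D N), Function.Surjective F) ∧
    (Nonempty (Evasion.EvasionPath D C N) ↔
      Nonempty (Evasion.ZigzagLimit k S (Evasion.essentialBoundary D N))) ∧
    Cardinal.mk (Evasion.ZigzagLimit k S (Evasion.essentialBoundary D N)) ≤
      Cardinal.lift.{u} (Cardinal.mk (ZerothHomotopy (Evasion.EvasionPath D C N))) := by
  obtain ⟨F, hF⟩ := Evasion.exists_surjective_zigzagLimit (k := k) (by omega) hD.isCompact hC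
    hconn S
  refine ⟨⟨F, hF⟩, ⟨fun ⟨δ⟩ => ⟨F (Quotient.mk _ δ)⟩, fun ⟨χ⟩ => ?_⟩, ?_⟩
  · obtain ⟨q, -⟩ := hF χ
    obtain ⟨δ, -⟩ := Quotient.exists_rep q
    exact ⟨δ⟩
  -- Evasion paths live in the lowest universe and the limit in that of `k`, so the cardinals are
  -- compared after lifting.
  · have := Cardinal.mk_le_of_surjective (f := F ∘ ULift.down.{u})
      (hF.comp ULift.down_surjective)
    rwa [Cardinal.mk_uLift] at this
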